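/- Let $d\ge 0$, $X=\mathbb R^d$ with its Euclidean structure, and let $\mathscr B$ be the algebra of bounded operators on the complex Hilbert space $L^2(X)$, with operator norm $\|\cdot\|$. For $a\in X$ let $\mathrm e^{\mathrm iaq}$ and $\mathrm e^{\mathrm iap}$ be the unitary operators $(\mathrm e^{\mathrm iaq}u)(x)=\mathrm e^{\mathrm i a\cdot x}u(x)$ and $(\mathrm e^{\mathrm iap}u)(x)=u(x+a)$, and for $A\in\mathscr B$ put $\tau_a(A)=\mathrm e^{\mathrm iap}A\,\mathrm e^{-\mathrm iap}$. Let $$\mathscr E=\Big\{A\in\mathscr B\ \Big|\ \lim_{a\to0}\|(\mathrm e^{\mathrm iap}-1)A\|=0,\ \lim_{a\to0}\|(\mathrm e^{\mathrm iap}-1)A^*\|=0,\ \lim_{a\to0}\|\mathrm e^{-\mathrm iaq}A\,\mathrm e^{\mathrm iaq}-A\|=0\Big\}.$$ The local norm topology on $\mathscr B$ is the topology defined by the seminorms $A\mapsto\|A\,\theta(q)\|$, where $\theta$ runs over the continuous functions $X\to\mathbb C$ that tend to zero at infinity and $\theta(q)$ is the operator of multiplication by $\theta$. Let $\mathscr E_{\mathrm{loc}}$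 be the set $\mathscr E$ with the topology inherited from the local norm topology. The operator spectrum $\sigma_{\mathrm{op}}(A)$ of $A\in\mathscr B$ is the set of all $B\in\mathscr B$ for which there is a sequence $(x_n)$ in $X$ with $|x_n|\to\infty$ such that $\tau_{x_n}(A)\to B$ in the local norm topology. Let $\mathrm{Sp}(A)$ be the spectrum of $A$ in $\mathscr B$, and let $\mathrm{Sp_{ess}}(A)$ be the set of $\lambda\in\mathbb C$ such that $A-\lambda$ is not a Fredholm operator. Theorem. Let $A\in\mathscr E$. Then $\{\tau_x(A)\mid x\in X\}$ is contained in $\mathscr E$ and is relatively compact in $\mathscr E_{\mathrm{loc}}$ (its closure in $\mathscr E_{\mathrm{loc}}$ is compact), and $\sigma_{\mathrm{op}}(A)$ is contained in $\mathscr E$ and is a compact subset of $\mathscr E_{\mathrm{loc}}$. Moreover $$\mathrm{Sp_{ess}}(A)=\bigcup_{B\in\sigma_{\mathrm{op}}(A)}\mathrm{Sp}(B).$$ -/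

import Mathlib

open MeasureTheory Filter Topology
open scoped ENNReal BoundedContinuousFunction ZeroAtInfty InnerProduct

noncomputable section

namespace EllipticAlgebra

/-- The configuration space `X = ℝ^d` with its Euclidean structure. -/
abbrev X (d : ℕ) : Type := EuclideanSpace ℝ (Fin d)

/-- The Hilbert space `L²(X)` of complex functions, for Lebesgue measure. -/
abbrev L2 (d : ℕ) : Type := Lp ℂ 2 (volume : Measure (X d))

/-- The algebra of all bounded operators on `L²(X)`, with its operator norm. -/
abbrev Op (d : ℕ) : Type := L2 d →L[ℂ] L2 d

variable {d : ℕ}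

/-- `φ(q)`: the operator of multiplication by a bounded continuous function `φ`. -/
def mulOp (φ : X d →ᵇ ℂ) : Op d :=
  (ContinuousLinearMap.mul ℂ ℂ).holderL volume ∞ 2 2 (φ.memLp_top (μ := volume)).toLp

theorem mulOp_apply_ae (φ : X d →ᵇ ℂ) (u : L2 d) :
    mulOp φ u =ᵐ[volume] fun x => φ x * u x := by
  refine (ContinuousLinearMap.coeFn_holder (r := 2) (ContinuousLinearMap.mul ℂ ℂ)
    (φ.memLp_top (μ := volume)).toLp u).trans ?_
  filter_upwards [(φ.memLp_top (μ := (volume : Measure (X d)))).coeFn_toLp] with x hx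
  simp [hx]

/-- `e^{iaq}`: multiplication by the function `x ↦ e^{i a·x}`. -/
def expQ (a : X d) : Op d := mulOp (BoundedContinuousFunction.innerProbChar a)

theorem expQ_apply_ae (a : X d) (u : L2 d) :
    expQ a u =ᵐ[volume] fun x => Complex.exp (inner ℝ a x * Complex.I) * u x := by
  refine (mulOp_apply_ae _ u).trans (Eventually.of_forall fun x => ?_)
  simp only [BoundedContinuousFunction.innerProbChar_apply, real_inner_comm]

/-- `e^{iap}`: the translation operator `(e^{iap}u)(x) = u(x + a)`. -/
def expP (a : X d) : Op d :=
  (Lp.compMeasurePreservingₗᵢ ℂ (fun x : X d => x + a)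
    (measurePreserving_add_right volume a)).toContinuousLinearMap

theorem expP_apply_ae (a : X d) (u : L2 d) :
    expP a u =ᵐ[volume] fun x => u (x + a) :=
  Lp.coeFn_compMeasurePreserving u (measurePreserving_add_right volume a)

/-- `τ_a(A) = e^{iap} A e^{-iap}`: the translate of the operator `A` by `a`. -/
def translateOp (a : X d) (A : Op d) : Op d := expP a * A * expP (-a)

variable (d) in
/-- The elliptic algebra of `X`: the operators `A` such that, in operator norm as `a → 0`,
`(e^{iap} - 1)A → 0`, `(e^{iap} - 1)A* → 0` and `e^{-iaq} A e^{iaq} → A`. -/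
def ellipticAlgebra : Set (Op d) :=
  {A | Tendsto (fun a : X d => ‖(expP a - 1) * A‖) (𝓝 0) (𝓝 0) ∧
    Tendsto (fun a : X d => ‖(expP a - 1) * ContinuousLinearMap.adjoint A‖) (𝓝 0) (𝓝 0) ∧
    Tendsto (fun a : X d => ‖expQ (-a) * A * expQ a - A‖) (𝓝 0) (𝓝 0)}

/-- The seminorm `‖A‖_θ = ‖A θ(q)‖` attached to a continuous `θ` vanishing at infinity. -/
def localSeminorm (θ : C₀(X d, ℂ)) : Seminorm ℂ (Op d) :=
  Seminorm.of (fun A => ‖A * mulOp θ.toBCF‖)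
    (fun A B => by simpa only [add_mul] using norm_add_le _ _)
    (fun c A => by simp only [smul_mul_assoc, norm_smul])

variable (d) in
/-- The space of bounded operators on `L²(X)`, to be equipped with the local norm topology. -/
def LocOp : Type := Op d

instance : AddCommGroup (LocOp d) := inferInstanceAs (AddCommGroup (Op d))
instance : Module ℂ (LocOp d) := inferInstanceAs (Module ℂ (Op d))

/-- The identity map, from `LocOp d` to the bounded operators. -/
def LocOp.toOp : LocOp d ≃ₗ[ℂ] Op d := LinearEquiv.refl ℂ (Op d)

variable (d) in
/-- The family of seminorms `‖·‖_θ`, `θ ∈ C₀(X)`. -/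
def localSeminormFamily : SeminormFamily ℂ (LocOp d) (C₀(X d, ℂ)) :=
  fun θ => (localSeminorm θ).comp (LocOp.toOp (d := d)).toLinearMap

/-- The local norm topology, defined by the seminorms `‖·‖_θ`. -/
instance : TopologicalSpace (LocOp d) := (localSeminormFamily d).moduleFilterBasis.topology

theorem withSeminorms_localSeminormFamily : WithSeminorms (localSeminormFamily d) := ⟨rfl⟩

variable (d) in
/-- The elliptic algebra with the topology inherited from the local norm topology. -/
abbrev EllLoc : Type := {A : LocOp d // LocOp.toOp A ∈ ellipticAlgebra d}

/-- A set of operators contained in the elliptic algebra, seen as a subset of `EllLoc d`. -/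
def inEllLoc (S : Set (Op d)) : Set (EllLoc d) := {A | LocOp.toOp A.1 ∈ S}

/-- The operator spectrum of `A`: all limits, in the local norm topology, of sequences
`τ_{x_n}(A)` with `|x_n| → ∞`. -/
def operatorSpectrum (A : Op d) : Set (Op d) :=
  {B | ∃ x : ℕ → X d, Tendsto (fun n => ‖x n‖) atTop atTop ∧
    Tendsto (fun n => LocOp.toOp.symm (translateOp (x n) A)) atTop (𝓝 (LocOp.toOp.symm B))}

/-- The essential spectrum of `A`: the `z ∈ ℂ` such that `A - z` is not Fredholm. -/
def essentialSpectrum (A : Op d) : Set ℂ :=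
  {z | ¬ (A - algebraMap ℂ (Op d) z).IsFredholm}

end EllipticAlgebra

end

open EllipticAlgebra

noncomputable section

namespace EllipticAlgebra

variable {d : ℕ}

/-! ### Multiplication operators, translations and modulations -/

/-! Compactness. Conjugation by a translation fixes `expP a` and multiplies `expQ a` by a phase, so
the three moduli of continuity that define the elliptic algebra are the same for all translates of
`A`. The translates and their strong limits therefore lie in `regClass A`. Let `B` be in this class
and let θ have compact support. A slowly varying cut-off χ almost commutes with `B` (third modulus),
so Bθ ≈ χBθ. A quantitative Riesz–Kolmogorov theorem, `exists_finRank_approx`, gives χB ≈ FB (first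
modulus) and, through adjoints, Bθ ≈ BF' (second modulus), where the finite rank operators F and F'
do not depend on `B`. Thus Bθ ≈ FBF', which is given by finitely many bounded coefficients: this is
`totallyBounded_regClass_mul_weight`. On bounded sets the seminorm of one positive function,
`weight`, already defines the local norm topology, so `regClass A` is compact and the operator
spectrum is closed in it.

If `A - z` is Fredholm, it is bounded below up to a finite rank term. Apply that bound to translated
vectors: translations to infinity tend weakly to zero, so the finite rank term disappears in the
limit, and `B - z` is bounded below for every limit operator `B`. The same holds for the adjoints,
so `B - z` is invertible.

Conversely let z ≠ 0, and look at unit vectors that `A - z` nearly kills. If they all keep a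
definite mass near the origin, then `A - z` is bounded below modulo a compact operator, because χA
is nearly of finite rank and z ≠ 0 (`exists_estimate_of_concentrated`). Such bounds for `A - z` and
its adjoint make `A - z` Fredholm. Otherwise some of these vectors live far away. By Plancherel in
the centre of the cut-off, their localizations at a large enough scale are on average still nearly
killed, and `exists_good_point` finds one distant point that serves many scales at once. Translating
these points to the origin produces a limit operator with approximate null vectors of every accuracy
(`exists_mem_operatorSpectrum_not_isUnit`). Fixing all the scales before passing to the limit is
what yields the union of spectra itself, with no closure. For z = 0 and d ≥ 1 no element of the
algebra is invertible; for d = 0 every operator is Fredholm. -/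

theorem eLpNorm_two_sq {α E : Type*} [MeasurableSpace α] {μ : Measure α} [NormedAddCommGroup E]
    (f : α → E) : eLpNorm f 2 μ ^ 2 = ∫⁻ x, ‖f x‖ₑ ^ 2 ∂μ := by
  rw [eLpNorm_eq_lintegral_rpow_enorm_toReal (by norm_num) (by norm_num)]
  simp only [ENNReal.toReal_ofNat, ENNReal.rpow_two, one_div]
  rw [← ENNReal.rpow_natCast, ← ENNReal.rpow_mul]
  norm_num

theorem enorm_sq_eq_lintegral (u : L2 d) : ‖u‖ₑ ^ 2 = ∫⁻ x, ‖u x‖ₑ ^ 2 := by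
  rw [Lp.enorm_def, eLpNorm_two_sq]

theorem le_of_sq_le_sq {a b : ℝ≥0∞} (h : a ^ 2 ≤ b ^ 2) : a ≤ b :=
  (ENNReal.pow_le_pow_left_iff two_ne_zero).1 h

theorem tendsto_zero_of_sq {α : Type*} {l : Filter α} {f : α → ℝ≥0∞}
    (h : Tendsto (fun a => f a ^ 2) l (𝓝 0)) : Tendsto f l (𝓝 0) := by
  have h2 := ((ENNReal.continuous_rpow_const (y := (2 : ℝ)⁻¹)).tendsto 0).comp h
  rw [ENNReal.zero_rpow_of_pos (by norm_num)] at h2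
  refine h2.congr fun a => ?_
  rw [Function.comp, ← ENNReal.rpow_natCast, ← ENNReal.rpow_mul]
  norm_num

theorem op_ext_ae {S T : Op d} (h : ∀ u : L2 d, S u =ᵐ[volume] T u) : S = T :=
  ContinuousLinearMap.ext fun u => Lp.ext (h u)

theorem mulOp_mul (φ ψ : X d →ᵇ ℂ) : mulOp (φ * ψ) = mulOp φ * mulOp ψ := by
  refine op_ext_ae fun u => ?_
  filter_upwards [mulOp_apply_ae (φ * ψ) u, mulOp_apply_ae φ (mulOp ψ u), mulOp_apply_ae ψ u]
    with x h1 h2 h3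
  rw [mul_apply_eq_comp, h1, h2, h3, BoundedContinuousFunction.mul_apply, mul_assoc]

theorem mulOp_one : mulOp (1 : X d →ᵇ ℂ) = 1 := by
  refine op_ext_ae fun u => ?_
  filter_upwards [mulOp_apply_ae 1 u] with x h1
  rw [h1]; simp

theorem mulOp_sub (φ ψ : X d →ᵇ ℂ) : mulOp (φ - ψ) = mulOp φ - mulOp ψ := by
  refine op_ext_ae fun u => ?_
  rw [sub_apply]
  filter_upwards [mulOp_apply_ae (φ - ψ) u, mulOp_apply_ae φ u, mulOp_apply_ae ψ u,
    Lp.coeFn_sub (mulOp φ u) (mulOp ψ u)] with x h1 h2 h3 h4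
  rw [h1, h4, Pi.sub_apply, h2, h3, BoundedContinuousFunction.sub_apply, sub_mul]

theorem norm_mulOp_apply_le (φ : X d →ᵇ ℂ) (u : L2 d) : ‖mulOp φ u‖ ≤ ‖φ‖ * ‖u‖ := by
  refine Lp.norm_le_mul_norm_of_ae_le_mul ?_
  filter_upwards [mulOp_apply_ae φ u] with x h
  rw [h, norm_mul]
  exact mul_le_mul_of_nonneg_right (φ.norm_coe_le_norm x) (norm_nonneg _)

theorem norm_mulOp_le (φ : X d →ᵇ ℂ) : ‖mulOp φ‖ ≤ ‖φ‖ :=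
  ContinuousLinearMap.opNorm_le_bound _ (norm_nonneg _) (norm_mulOp_apply_le φ)

theorem adjoint_mulOp (φ : X d →ᵇ ℂ) :
    ContinuousLinearMap.adjoint (mulOp φ) = mulOp (star φ) := by
  symm
  rw [ContinuousLinearMap.eq_adjoint_iff]
  intro u v
  rw [L2.inner_def, L2.inner_def]
  refine integral_congr_ae ?_
  filter_upwards [mulOp_apply_ae (star φ) u, mulOp_apply_ae φ v] with x h1 h2
  rw [h1, h2]
  simp only [RCLike.inner_apply, BoundedContinuousFunction.star_apply, map_mul, RCLike.star_def,
    RCLike.conj_conj]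
  ring

theorem expP_zero : expP (0 : X d) = 1 := by
  refine op_ext_ae fun u => ?_
  filter_upwards [expP_apply_ae 0 u] with x h
  rw [h, add_zero]; rfl

theorem expP_mul (a b : X d) : expP a * expP b = expP (a + b) := by
  refine op_ext_ae fun u => ?_
  filter_upwards [expP_apply_ae (a + b) u, expP_apply_ae a (expP b u),
    (measurePreserving_add_right volume a).quasiMeasurePreserving.ae_eq_comp (expP_apply_ae b u)]
    with x h1 h2 h3
  rw [mul_apply_eq_comp, h1, h2]
  simpa [add_assoc] using h3

theorem expP_mul_neg (a : X d) : expP a * expP (-a) = 1 := by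
  rw [expP_mul, add_neg_cancel, expP_zero]

theorem expP_neg_mul (a : X d) : expP (-a) * expP a = 1 := by
  rw [expP_mul, neg_add_cancel, expP_zero]

theorem norm_expP_apply (a : X d) (u : L2 d) : ‖expP a u‖ = ‖u‖ :=
  (Lp.compMeasurePreservingₗᵢ ℂ (fun x : X d => x + a)
    (measurePreserving_add_right volume a)).norm_map u

theorem adjoint_expP (a : X d) : ContinuousLinearMap.adjoint (expP a) = expP (-a) := by
  symm
  rw [ContinuousLinearMap.eq_adjoint_iff]
  intro u v
  have h := (Lp.compMeasurePreservingₗᵢ ℂ (fun x : X d => x + a)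
    (measurePreserving_add_right volume a)).inner_map_map (expP (-a) u) v
  have h2 : (Lp.compMeasurePreservingₗᵢ ℂ (fun x : X d => x + a)
    (measurePreserving_add_right volume a)) (expP (-a) u) = u := by
    change (expP a * expP (-a)) u = u
    rw [expP_mul_neg]; rfl
  rw [h2] at h
  exact h.symm

/-- The translate `x ↦ φ (x + a)` of a bounded continuous function. -/
def shift (a : X d) (φ : X d →ᵇ ℂ) : X d →ᵇ ℂ :=
  φ.compContinuous ⟨fun x => x + a, by fun_prop⟩

theorem shift_apply (a : X d) (φ : X d →ᵇ ℂ) (x : X d) : shift a φ x = φ (x + a) := rfl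

theorem expP_mul_mulOp (a : X d) (φ : X d →ᵇ ℂ) :
    expP a * mulOp φ = mulOp (shift a φ) * expP a := by
  refine op_ext_ae fun u => ?_
  filter_upwards [expP_apply_ae a (mulOp φ u), mulOp_apply_ae (shift a φ) (expP a u),
    expP_apply_ae a u,
    (measurePreserving_add_right volume a).quasiMeasurePreserving.ae_eq_comp (mulOp_apply_ae φ u)]
    with x h1 h2 h3 h4
  rw [mul_apply_eq_comp, mul_apply_eq_comp, h1, h2, h3, shift_apply]
  exact h4

theorem expQ_zero : expQ (0 : X d) = 1 := by
  refine op_ext_ae fun u => ?_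
  filter_upwards [expQ_apply_ae 0 u] with x h
  rw [h]; simp

theorem expQ_mul (a b : X d) : expQ a * expQ b = expQ (a + b) := by
  refine op_ext_ae fun u => ?_
  filter_upwards [expQ_apply_ae (a + b) u, expQ_apply_ae a (expQ b u), expQ_apply_ae b u]
    with x h1 h2 h3
  rw [mul_apply_eq_comp, h1, h2, h3, inner_add_left, ← mul_assoc, ← Complex.exp_add]
  push_cast
  ring_nf

theorem expQ_mul_neg (a : X d) : expQ a * expQ (-a) = 1 := by
  rw [expQ_mul, add_neg_cancel, expQ_zero]

theorem expQ_neg_mul (a : X d) : expQ (-a) * expQ a = 1 := by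
  rw [expQ_mul, neg_add_cancel, expQ_zero]

theorem adjoint_expQ (a : X d) : ContinuousLinearMap.adjoint (expQ a) = expQ (-a) := by
  rw [expQ, adjoint_mulOp, expQ]
  congr 1
  ext x
  rw [BoundedContinuousFunction.star_apply, BoundedContinuousFunction.innerProbChar_apply,
    BoundedContinuousFunction.innerProbChar_apply, RCLike.star_def, ← Complex.exp_conj]
  simp

theorem norm_expQ_apply (a : X d) (u : L2 d) : ‖expQ a u‖ = ‖u‖ := by
  have h : ∀ (b : X d) (v : L2 d), ‖expQ b v‖ ≤ ‖v‖ := fun b v => by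
    refine Lp.norm_le_norm_of_ae_le ?_
    filter_upwards [expQ_apply_ae b v] with x hx
    rw [hx, norm_mul, Complex.norm_exp_ofReal_mul_I, one_mul]
  refine le_antisymm (h a u) ?_
  have h2 := h (-a) (expQ a u)
  rwa [← mul_apply_eq_comp, expQ_neg_mul] at h2

/-- The Weyl commutation relation. -/
theorem expP_mul_expQ (a k : X d) :
    expP a * expQ k = Complex.exp (inner ℝ k a * Complex.I) • (expQ k * expP a) := by
  refine op_ext_ae fun u => ?_
  rw [smul_apply]
  filter_upwards [expP_apply_ae a (expQ k u), expQ_apply_ae k (expP a u), expP_apply_ae a u,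
    (measurePreserving_add_right volume a).quasiMeasurePreserving.ae_eq_comp (expQ_apply_ae k u),
    Lp.coeFn_smul (Complex.exp (inner ℝ k a * Complex.I)) ((expQ k * expP a) u)]
    with x h1 h2 h3 h4 h5
  rw [h5, Pi.smul_apply, mul_apply_eq_comp, mul_apply_eq_comp, h1, h2, h3,
    smul_eq_mul, ← mul_assoc, ← Complex.exp_add]
  refine h4.trans ?_
  simp only [Function.comp, inner_add_right]
  push_cast
  ring_nf

theorem norm_expP_mul (a : X d) (S : Op d) : ‖expP a * S‖ = ‖S‖ := by
  have h : ∀ (b : X d) (S : Op d), ‖expP b * S‖ ≤ ‖S‖ := fun b S =>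
    ContinuousLinearMap.opNorm_le_bound _ (norm_nonneg _) fun u => by
      rw [mul_apply_eq_comp, norm_expP_apply]
      exact S.le_opNorm u
  refine le_antisymm (h a S) ?_
  have h2 := h (-a) (expP a * S)
  rwa [← mul_assoc, expP_neg_mul, one_mul] at h2

theorem norm_mul_expP (a : X d) (S : Op d) : ‖S * expP a‖ = ‖S‖ := by
  rw [← LinearIsometryEquiv.norm_map ContinuousLinearMap.adjoint (S * expP a),
    ContinuousLinearMap.mul_def, ContinuousLinearMap.adjoint_comp, adjoint_expP,
    ← ContinuousLinearMap.mul_def, norm_expP_mul, LinearIsometryEquiv.norm_map]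

theorem norm_expQ_mul (a : X d) (S : Op d) : ‖expQ a * S‖ = ‖S‖ := by
  have h : ∀ (b : X d) (S : Op d), ‖expQ b * S‖ ≤ ‖S‖ := fun b S =>
    ContinuousLinearMap.opNorm_le_bound _ (norm_nonneg _) fun u => by
      rw [mul_apply_eq_comp, norm_expQ_apply]
      exact S.le_opNorm u
  refine le_antisymm (h a S) ?_
  have h2 := h (-a) (expQ a * S)
  rwa [← mul_assoc, expQ_neg_mul, one_mul] at h2

theorem norm_mul_expQ (a : X d) (S : Op d) : ‖S * expQ a‖ = ‖S‖ := by
  rw [← LinearIsometryEquiv.norm_map ContinuousLinearMap.adjoint (S * expQ a),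
    ContinuousLinearMap.mul_def, ContinuousLinearMap.adjoint_comp, adjoint_expQ,
    ← ContinuousLinearMap.mul_def, norm_expQ_mul, LinearIsometryEquiv.norm_map]

theorem adjoint_mul (S T : Op d) : ContinuousLinearMap.adjoint (S * T) =
    ContinuousLinearMap.adjoint T * ContinuousLinearMap.adjoint S :=
  ContinuousLinearMap.adjoint_comp S T

theorem adjoint_one : ContinuousLinearMap.adjoint (1 : Op d) = 1 :=
  ContinuousLinearMap.adjoint_id

theorem continuous_expQ_apply (u : L2 d) : Continuous fun a : X d => expQ a u := by
  rw [continuous_iff_continuousAt]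
  intro a
  rw [ContinuousAt, tendsto_iff_edist_tendsto_0]
  have key : ∀ b : X d, edist (expQ b u) (expQ a u) ^ 2 =
      ∫⁻ x, (‖Complex.exp (inner ℝ b x * Complex.I) - Complex.exp (inner ℝ a x * Complex.I)‖ₑ
        * ‖u x‖ₑ) ^ 2 := fun b => by
    rw [edist_eq_enorm_sub, enorm_sq_eq_lintegral]
    refine lintegral_congr_ae ?_
    filter_upwards [expQ_apply_ae b u, expQ_apply_ae a u, Lp.coeFn_sub (expQ b u) (expQ a u)]
      with x h1 h2 h3
    rw [h3, Pi.sub_apply, h1, h2, ← sub_mul, enorm_mul]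
  have h2 : Tendsto (fun b : X d => edist (expQ b u) (expQ a u) ^ 2) (𝓝 a) (𝓝 0) := by
    simp_rw [key]
    have h0 : (0 : ℝ≥0∞) = ∫⁻ x : X d, 0 := by simp
    rw [h0]
    refine tendsto_lintegral_filter_of_dominated_convergence (fun x => (2 * ‖u x‖ₑ) ^ 2)
      (Eventually.of_forall fun b => ?_) (Eventually.of_forall fun b => Eventually.of_forall
        fun x => ?_) ?_ (Eventually.of_forall fun x => ?_)
    · have : Measurable (u : X d → ℂ) := (Lp.stronglyMeasurable u).measurable
      fun_prop
    · gcongr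
      refine (enorm_sub_le ..).trans ?_
      have h : ∀ c : X d, ‖Complex.exp (inner ℝ c x * Complex.I)‖ₑ = 1 := fun c => by
        rw [← ofReal_norm, Complex.norm_exp_ofReal_mul_I, ENNReal.ofReal_one]
      rw [h, h]; norm_num
    · simp_rw [mul_pow]
      rw [lintegral_const_mul' _ _ (by norm_num), ← enorm_sq_eq_lintegral]
      exact (ENNReal.mul_lt_top (by norm_num) (by simp)).ne
    · have hc : Tendsto (fun b : X d => ‖Complex.exp (inner ℝ b x * Complex.I) -
          Complex.exp (inner ℝ a x * Complex.I)‖ₑ) (𝓝 a) (𝓝 0) := by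
        have : Continuous fun b : X d => ‖Complex.exp (inner ℝ b x * Complex.I) -
          Complex.exp (inner ℝ a x * Complex.I)‖ₑ := by fun_prop
        simpa using this.tendsto a
      simpa using ENNReal.Tendsto.pow (n := 2)
        (ENNReal.Tendsto.mul_const hc (b := ‖u x‖ₑ) (Or.inr (by simp)))
  exact tendsto_zero_of_sq h2

/-! ### Operators at least as regular as a given one -/

theorem continuous_expP_apply (u : L2 d) : Continuous fun a : X d => expP a u := by
  let g : C(X d, C(X d, X d)) := ContinuousMap.curry ⟨fun p : X d × X d => p.2 + p.1, by fun_prop⟩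
  exact continuous_const.compMeasurePreservingLp (p := 2) (f := fun _ : X d => u) g.continuous
    (fun a => measurePreserving_add_right volume a) (by norm_num)

theorem norm_le_of_strong_limit {ι : Type*} {l : Filter ι} [l.NeBot] {S : ι → Op d} {T : Op d}
    {c : ℝ} (hc : ∀ i, ‖S i‖ ≤ c) (h : ∀ u, Tendsto (fun i => S i u) l (𝓝 (T u))) : ‖T‖ ≤ c := by
  obtain ⟨i⟩ := l.nonempty_of_neBot
  refine T.opNorm_le_bound ((norm_nonneg _).trans (hc i)) fun u => ?_
  exact le_of_tendsto (h u).norm (Eventually.of_forall fun i => (S i).le_of_opNorm_le (hc i) u)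

theorem norm_conj_expQ_sub (a : X d) (A : Op d) :
    ‖expQ (-a) * A * expQ a - A‖ = ‖A * expQ a - expQ a * A‖ := by
  rw [← norm_expQ_mul a (expQ (-a) * A * expQ a - A), mul_sub, mul_assoc, ← mul_assoc (expQ a),
    expQ_mul_neg, one_mul]

theorem norm_mul_expP_sub_one (a : X d) (A : Op d) :
    ‖(expP a - 1) * ContinuousLinearMap.adjoint A‖ = ‖A * (expP a - 1)‖ := by
  rw [← LinearIsometryEquiv.norm_map ContinuousLinearMap.adjoint (_ * _), adjoint_mul,
    ContinuousLinearMap.adjoint_adjoint, map_sub, adjoint_expP, adjoint_one,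
    ← norm_mul_expP a (A * (expP (-a) - 1)), mul_assoc, sub_mul, expP_neg_mul, one_mul, mul_sub,
    mul_sub, norm_sub_rev]

/-- The second condition is moved from the adjoint to right multiplication because strong limits,
which are used below, do not pass to adjoints. -/
theorem mem_ellipticAlgebra_iff {A : Op d} : A ∈ ellipticAlgebra d ↔
    Tendsto (fun a : X d => ‖(expP a - 1) * A‖) (𝓝 0) (𝓝 0) ∧
    Tendsto (fun a : X d => ‖A * (expP a - 1)‖) (𝓝 0) (𝓝 0) ∧
    Tendsto (fun a : X d => ‖A * expQ a - expQ a * A‖) (𝓝 0) (𝓝 0) := by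
  simp only [ellipticAlgebra, Set.mem_ofPred_eq, norm_conj_expQ_sub, norm_mul_expP_sub_one]

theorem adjoint_mem_ellipticAlgebra {A : Op d} (hA : A ∈ ellipticAlgebra d) :
    ContinuousLinearMap.adjoint A ∈ ellipticAlgebra d := by
  refine ⟨hA.2.1, ?_, ?_⟩
  · simpa using hA.1
  · refine hA.2.2.congr fun a => ?_
    rw [← LinearIsometryEquiv.norm_map ContinuousLinearMap.adjoint (_ * _ * _ - _), map_sub,
      adjoint_mul, adjoint_mul, adjoint_expQ, adjoint_expQ, neg_neg, mul_assoc]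

/-- The operators that are bounded by `A`, and whose moduli of regularity in momentum and in
position are bounded by those of `A`. -/
def regClass (A : Op d) : Set (Op d) :=
  {B | ‖B‖ ≤ ‖A‖ ∧ ∀ a : X d, ‖(expP a - 1) * B‖ ≤ ‖(expP a - 1) * A‖ ∧
    ‖B * (expP a - 1)‖ ≤ ‖A * (expP a - 1)‖ ∧
    ‖B * expQ a - expQ a * B‖ ≤ ‖A * expQ a - expQ a * A‖}

theorem regClass_subset_ellipticAlgebra {A : Op d} (hA : A ∈ ellipticAlgebra d) :
    regClass A ⊆ ellipticAlgebra d := by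
  intro B hB
  rw [mem_ellipticAlgebra_iff] at hA ⊢
  exact ⟨squeeze_zero (fun _ => norm_nonneg _) (fun a => (hB.2 a).1) hA.1,
    squeeze_zero (fun _ => norm_nonneg _) (fun a => (hB.2 a).2.1) hA.2.1,
    squeeze_zero (fun _ => norm_nonneg _) (fun a => (hB.2 a).2.2) hA.2.2⟩

theorem norm_translateOp (x : X d) (A : Op d) : ‖translateOp x A‖ = ‖A‖ := by
  rw [translateOp, norm_mul_expP, norm_expP_mul]

theorem translateOp_mem_regClass (x : X d) (A : Op d) : translateOp x A ∈ regClass A := by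
  refine ⟨(norm_translateOp x A).le, fun a => ⟨le_of_eq ?_, le_of_eq ?_, le_of_eq ?_⟩⟩
  · have : (expP a - 1) * translateOp x A = translateOp x ((expP a - 1) * A) := by
      have h := expP_mul a x
      rw [add_comm, ← expP_mul] at h
      simp only [translateOp, sub_mul, mul_sub, one_mul, ← mul_assoc, h]
    rw [this, norm_translateOp]
  · have : translateOp x A * (expP a - 1) = translateOp x (A * (expP a - 1)) := by
      have h := expP_mul (-x) a
      rw [add_comm, ← expP_mul] at h
      simp only [translateOp, sub_mul, mul_sub, mul_one, mul_assoc, h]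
    rw [this, norm_translateOp]
  -- Both terms of the commutator acquire the same phase when `expQ a` is moved across the
  -- translations, so it factors out.
  · have h1 := expP_mul_expQ (-x) a
    have h2 : expQ a * expP x = Complex.exp (inner ℝ a (-x) * Complex.I) • (expP x * expQ a) := by
      rw [expP_mul_expQ, smul_smul, ← Complex.exp_add, inner_neg_right]
      simp
    have : translateOp x A * expQ a - expQ a * translateOp x A =
        Complex.exp (inner ℝ a (-x) * Complex.I) • translateOp x (A * expQ a - expQ a * A) := by
      simp only [translateOp]
      rw [mul_assoc, h1, ← mul_assoc (expQ a), ← mul_assoc (expQ a), h2, mul_sub, sub_mul,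
        smul_sub]
      simp only [mul_assoc, smul_mul_assoc, mul_smul_comm]
    rw [this, norm_smul, Complex.norm_exp_ofReal_mul_I, one_mul, norm_translateOp]

theorem mem_regClass_of_strong_limit {A : Op d} {ι : Type*} {l : Filter ι} [l.NeBot]
    {S : ι → Op d} {T : Op d} (hS : ∀ i, S i ∈ regClass A)
    (h : ∀ u, Tendsto (fun i => S i u) l (𝓝 (T u))) : T ∈ regClass A := by
  refine ⟨norm_le_of_strong_limit (fun i => (hS i).1) h, fun a => ⟨?_, ?_, ?_⟩⟩
  · refine norm_le_of_strong_limit (l := l) (fun i => ((hS i).2 a).1) fun u => ?_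
    exact ((expP a - 1).continuous.tendsto _).comp (h u)
  · refine norm_le_of_strong_limit (l := l) (fun i => ((hS i).2 a).2.1) fun u => ?_
    exact h ((expP a - 1) u)
  · refine norm_le_of_strong_limit (l := l) (fun i => ((hS i).2 a).2.2) fun u => ?_
    exact (h (expQ a u)).sub (((expQ a).continuous.tendsto _).comp (h u))

theorem adjoint_translateOp (x : X d) (A : Op d) :
    ContinuousLinearMap.adjoint (translateOp x A) =
      translateOp x (ContinuousLinearMap.adjoint A) := by
  rw [translateOp, adjoint_mul, adjoint_mul, adjoint_expP, adjoint_expP, neg_neg, translateOp,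
    mul_assoc]

/-! ### Plancherel's theorem for integrable and square integrable functions -/

-- The values lie in a Hilbert space because this is applied to functions with values in `L2 d`. The
-- Fourier transform given by the integral and the one on L² agree almost everywhere, since they
-- have the same integrals against smooth functions of compact support.
open scoped FourierTransform SchwartzMap ContDiff in
theorem lintegral_enorm_sq_fourier {H : Type*} [NormedAddCommGroup H] [InnerProductSpace ℂ H]
    [CompleteSpace H] {G : X d → H} (hG : Integrable G) (hG2 : MemLp G 2) :
    ∫⁻ y, ‖𝓕 G y‖ₑ ^ 2 = ∫⁻ k, ‖G k‖ₑ ^ 2 := by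
  have hcont : Continuous (𝓕 G) :=
    VectorFourier.fourierIntegral_continuous Real.continuous_fourierChar continuous_inner hG
  have hae : (𝓕 (hG2.toLp G) : Lp H 2 (volume : Measure (X d))) =ᵐ[volume] 𝓕 G := by
    refine ae_eq_of_integral_contDiff_smul_eq
      ((Lp.memLp _).locallyIntegrable (by norm_num)) hcont.locallyIntegrable fun g hg hgc => ?_
    have hg₁ : HasCompactSupport (Complex.ofRealCLM ∘ g) := hgc.comp_left rfl
    have hg₂ : ContDiff ℝ ∞ (Complex.ofRealCLM ∘ g) := by fun_prop
    set s : 𝓢(X d, ℂ) := hg₁.toSchwartzMap hg₂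
    have h1 := congrArg (fun T => T s) (Lp.fourier_toTemperedDistribution_eq (hG2.toLp G))
    simp only [TemperedDistribution.fourier_apply, Lp.toTemperedDistribution_apply] at h1
    have h2 : ∫ x, (𝓕 s) x • (hG2.toLp G) x = ∫ x, (𝓕 s) x • G x := by
      refine integral_congr_ae ?_
      filter_upwards [hG2.coeFn_toLp] with x hx
      rw [hx]
    have h3 : ∫ x, (𝓕 s) x • G x = ∫ x, s x • 𝓕 G x := by
      simpa using! (VectorFourier.integral_fourierIntegral_smul_eq_flip (L := innerₗ (X d))
        Real.continuous_fourierChar continuous_inner s.integrable hG)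
    have h4 : ∀ f : X d → H, ∫ x, g x • f x = ∫ x, s x • f x := fun f =>
      integral_congr_ae (Eventually.of_forall fun x => by simp [s])
    rw [h4, h4, ← h3, ← h2, h1]
  have hn : ∀ v : Lp H 2 (volume : Measure (X d)), ‖v‖ₑ ^ 2 = ∫⁻ x, ‖v x‖ₑ ^ 2 := fun v => by
    rw [Lp.enorm_def, eLpNorm_two_sq]
  have h5 := hn (𝓕 (hG2.toLp G))
  have h6 := hn (hG2.toLp G)
  have h7 : ‖(𝓕 (hG2.toLp G) : Lp H 2 (volume : Measure (X d)))‖ₑ = ‖hG2.toLp G‖ₑ := by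
    rw [← ofReal_norm, ← ofReal_norm, Lp.norm_fourier_eq]
  rw [h7, h6] at h5
  calc _ = ∫⁻ x, ‖(𝓕 (hG2.toLp G) : Lp H 2 (volume : Measure (X d))) x‖ₑ ^ 2 := by
        refine lintegral_congr_ae ?_
        filter_upwards [hae] with x hx
        rw [hx]
    _ = ∫⁻ x, ‖hG2.toLp G x‖ₑ ^ 2 := h5.symm
    _ = _ := by
        refine lintegral_congr_ae ?_
        filter_upwards [hG2.coeFn_toLp] with x hx
        rw [hx]

/-! ### Multiplication operators as superpositions of modulations -/

theorem integrable_smul_expQ {g : X d → ℂ} (hg : Integrable g) (c : ℝ) (u : L2 d) :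
    Integrable fun k : X d => g k • expQ (c • k) u := by
  have hc : Continuous fun k : X d => expQ (c • k) u :=
    (continuous_expQ_apply u).comp (continuous_const_smul c)
  refine (hg.norm.mul_const ‖u‖).mono' (hg.aestronglyMeasurable.smul hc.aestronglyMeasurable)
    (Eventually.of_forall fun k => ?_)
  rw [norm_smul, norm_expQ_apply]

/-- Fubini, after pairing both sides with an arbitrary vector. -/
theorem mulOp_apply_eq_integral {g : X d → ℂ} (hg : Integrable g) (c : ℝ) (φ : X d →ᵇ ℂ)
    (hφ : ∀ x, φ x = ∫ k, g k * Complex.exp (inner ℝ (c • k) x * Complex.I)) (u : L2 d) :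
    mulOp φ u = ∫ k, g k • expQ (c • k) u := by
  refine ext_inner_left ℂ fun v => ?_
  rw [← integral_inner (integrable_smul_expQ hg c u)]
  have hw : Integrable fun x => u x * (starRingEnd ℂ) (v x) := by
    have := L2.integrable_inner (𝕜 := ℂ) v u
    simpa [RCLike.inner_apply] using this
  have h1 : ∀ k, inner ℂ v (g k • expQ (c • k) u) = ∫ x, Complex.exp (inner ℝ (c • k) x * Complex.I) *
      (g k * (u x * (starRingEnd ℂ) (v x))) := fun k => by
    rw [inner_smul_right, L2.inner_def, ← integral_const_mul]
    refine integral_congr_ae ?_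
    filter_upwards [expQ_apply_ae (c • k) u] with x hx
    rw [hx, RCLike.inner_apply]
    ring
  simp_rw [h1]
  have hint : Integrable (Function.uncurry fun (k x : X d) =>
      Complex.exp (inner ℝ (c • k) x * Complex.I) * (g k * (u x * (starRingEnd ℂ) (v x))))
      (volume.prod volume) := by
    refine (hg.mul_prod hw).bdd_mul (c := 1) ?_ (Eventually.of_forall fun p => ?_)
    · apply Continuous.aestronglyMeasurable
      fun_prop
    · rw [Complex.norm_exp_ofReal_mul_I]
  rw [integral_integral_swap hint, L2.inner_def]
  refine integral_congr_ae ?_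
  filter_upwards [mulOp_apply_ae φ u] with x hx
  rw [hx, RCLike.inner_apply, hφ, ← integral_mul_const, ← integral_mul_const]
  refine integral_congr_ae (Eventually.of_forall fun k => ?_)
  ring

/-! ### Localizing functions -/

variable (d) in
/-- A smooth function equal to `1` on the unit ball, with support in the ball of radius `2`. -/
def bumpBase : ContDiffBump (0 : X d) := ⟨1, 2, one_pos, one_lt_two⟩

open scoped SchwartzMap ContDiff in
variable (d) in
/-- The complex valued bump function, as a Schwartz function. -/
def bump : 𝓢(X d, ℂ) :=
  HasCompactSupport.toSchwartzMap (f := fun x => Complex.ofRealCLM (bumpBase d x))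
    ((bumpBase d).hasCompactSupport.comp_left (g := Complex.ofRealCLM) rfl)
    (Complex.ofRealCLM.contDiff.comp (bumpBase d).contDiff)

theorem bump_apply (x : X d) : bump d x = (bumpBase d x : ℂ) := rfl

theorem norm_bump_le (x : X d) : ‖bump d x‖ ≤ 1 := by
  rw [bump_apply, Complex.norm_real, Real.norm_of_nonneg (bumpBase d).nonneg]
  exact (bumpBase d).le_one

theorem bump_eq_one {x : X d} (hx : ‖x‖ ≤ 1) : bump d x = 1 := by
  rw [bump_apply, (bumpBase d).one_of_mem_closedBall (by simpa [bumpBase] using hx)]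
  simp

theorem bump_eq_zero {x : X d} (hx : 2 ≤ ‖x‖) : bump d x = 0 := by
  rw [bump_apply, (bumpBase d).zero_of_le_dist (by simpa [bumpBase] using hx)]
  simp

/-- The localizing function `x ↦ b (t x - z)`. -/
def loc (t : ℝ) (z : X d) : X d →ᵇ ℂ :=
  BoundedContinuousFunction.ofNormedAddCommGroup (fun x => bump d (t • x - z))
    ((bump d).continuous.comp (by fun_prop)) 1 fun _ => norm_bump_le _

theorem loc_apply (t : ℝ) (z x : X d) : loc t z x = bump d (t • x - z) := rfl

theorem norm_loc_le (t : ℝ) (z : X d) : ‖loc t z‖ ≤ 1 :=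
  BoundedContinuousFunction.norm_ofNormedAddCommGroup_le _ zero_le_one _

open scoped FourierTransform in
variable (d) in
/-- The Fourier transform of the bump function. -/
def bumpHat : SchwartzMap (X d) ℂ := 𝓕 (bump d)

open scoped FourierTransform in
theorem bump_eq_integral (w : X d) :
    bump d w = ∫ k, bumpHat d k * Complex.exp (2 * Real.pi * inner ℝ k w * Complex.I) := by
  have h : 𝓕⁻ (bumpHat d) = bump d := FourierTransform.fourierInv_fourier_eq (bump d)
  rw [← h, SchwartzMap.fourierInv_coe, Real.fourierInv_eq']
  refine integral_congr_ae (Eventually.of_forall fun k => ?_)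
  simp only [smul_eq_mul]
  push_cast
  ring

/-- Fourier inversion for the bump. The centre `z` enters only through a character of `k`, so as a
function of `z` the localized vector is a Fourier transform. -/
theorem mulOp_loc_apply (t : ℝ) (z : X d) (u : L2 d) :
    mulOp (loc t z) u = ∫ k, (bumpHat d k * Complex.exp (-(2 * Real.pi * inner ℝ k z) * Complex.I))
      • expQ ((2 * Real.pi * t) • k) u := by
  refine mulOp_apply_eq_integral ?_ _ _ (fun x => ?_) u
  · refine (bumpHat d).integrable.mul_bdd (c := 1) ?_ (Eventually.of_forall fun k => ?_)
    · apply Continuous.aestronglyMeasurable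
      fun_prop
    · rw [show (-(2 * Real.pi * inner ℝ k z) : ℂ) = ((-(2 * Real.pi * inner ℝ k z) : ℝ) : ℂ) by
        push_cast; rfl, Complex.norm_exp_ofReal_mul_I]
  · rw [loc_apply, bump_eq_integral]
    refine integral_congr_ae (Eventually.of_forall fun k => ?_)
    simp only [mul_assoc (bumpHat d k), ← Complex.exp_add]
    rw [inner_sub_right, inner_smul_right, inner_smul_left]
    simp only [conj_trivial]
    push_cast
    ring_nf

-- Plancherel in the variable `z`: averaging over the centres of the cut-offs turns localization
-- into modulation, which almost commutes with elements of the elliptic algebra when `t` is small.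
open scoped FourierTransform in
theorem lintegral_enorm_sq_mulOp_loc (T : Op d) (t : ℝ) (u : L2 d) :
    ∫⁻ z, ‖T (mulOp (loc t z) u)‖ₑ ^ 2 =
      ∫⁻ k, (‖bumpHat d k‖ₑ * ‖T (expQ ((2 * Real.pi * t) • k) u)‖ₑ) ^ 2 := by
  set G : X d → L2 d := fun k => bumpHat d k • T (expQ ((2 * Real.pi * t) • k) u)
  have hc : Continuous G := (bumpHat d).continuous.smul
    (T.continuous.comp ((continuous_expQ_apply u).comp (continuous_const_smul _)))
  have hle : ∀ k, ‖G k‖ ≤ ‖(‖T‖ * ‖u‖ : ℝ) • bumpHat d k‖ := fun k => by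
    rw [norm_smul, norm_smul, Real.norm_of_nonneg (by positivity), mul_comm]
    gcongr
    exact (T.le_opNorm _).trans_eq (by rw [norm_expQ_apply])
  have h1 : Integrable G := Integrable.mono ((bumpHat d).integrable.smul (‖T‖ * ‖u‖ : ℝ))
    hc.aestronglyMeasurable (Eventually.of_forall hle)
  have h2 : MemLp G 2 := MemLp.mono (((bumpHat d).memLp 2).const_smul (‖T‖ * ‖u‖ : ℝ))
    hc.aestronglyMeasurable (Eventually.of_forall hle)
  have h3 : ∀ z, 𝓕 G z = T (mulOp (loc t z) u) := fun z => by
    rw [mulOp_loc_apply, ← ContinuousLinearMap.integral_comp_comm, Real.fourier_eq']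
    · refine integral_congr_ae (Eventually.of_forall fun k => ?_)
      simp only [G, map_smul, smul_smul]
      congr 1
      push_cast
      ring_nf
    · refine integrable_smul_expQ ?_ _ _
      refine (bumpHat d).integrable.mul_bdd (c := 1) ?_ (Eventually.of_forall fun k => ?_)
      · apply Continuous.aestronglyMeasurable
        fun_prop
      · rw [show (-(2 * Real.pi * inner ℝ k z) : ℂ) = ((-(2 * Real.pi * inner ℝ k z) : ℝ) : ℂ) by
          push_cast; rfl, Complex.norm_exp_ofReal_mul_I]
  simp_rw [← h3]
  rw [lintegral_enorm_sq_fourier h1 h2]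
  simp only [G, enorm_smul]

/-- The size of the commutators of `A` with slowly oscillating modulations, weighted by the
Fourier transform of the bump function. -/
def slowModulus (A : Op d) (p : ℕ) (t : ℝ) : ℝ≥0∞ :=
  ∫⁻ k, (‖bumpHat d k‖ₑ *
    ‖A * expQ ((2 * Real.pi * t) • k) - expQ ((2 * Real.pi * t) • k) * A‖ₑ) ^ p

/-- The group law carries continuity from 0 to every point; this makes the integrand of
`slowModulus` measurable. -/
theorem continuous_norm_commutator_expQ {A : Op d} (hA : A ∈ ellipticAlgebra d) :
    Continuous fun a : X d => ‖A * expQ a - expQ a * A‖ := by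
  have h : Continuous fun a : X d => expQ (-a) * A * expQ a := by
    rw [continuous_iff_continuousAt]
    intro b
    rw [ContinuousAt, tendsto_iff_norm_sub_tendsto_zero]
    have h1 : Tendsto (fun a : X d => a - b) (𝓝 b) (𝓝 0) := by
      have : Continuous fun a : X d => a - b := by fun_prop
      simpa using this.tendsto b
    refine (hA.2.2.comp h1).congr fun a => ?_
    rw [Function.comp, ← norm_expQ_mul (-b), ← norm_mul_expQ b]
    congr 1
    rw [mul_sub, sub_mul, mul_assoc, mul_assoc, mul_assoc, expQ_mul, sub_add_cancel, ← mul_assoc,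
      expQ_mul]
    simp only [← mul_assoc]
    congr 4
    abel
  have h2 := (h.sub (continuous_const (y := A))).norm
  exact h2.congr fun a => norm_conj_expQ_sub a A

/-- Dominated convergence, the commutators being at most `2‖A‖`. The exponent 1 serves for
commutators with cut-offs, the exponent 2 for the averages over centres. -/
theorem tendsto_slowModulus {A : Op d} (hA : A ∈ ellipticAlgebra d) {p : ℕ} (hp : p ≠ 0) :
    Tendsto (slowModulus A p) (𝓝 0) (𝓝 0) := by
  have hω := continuous_norm_commutator_expQ hA
  have hω' : Continuous fun a : X d => ‖A * expQ a - expQ a * A‖ₑ := by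
    simp_rw [← ofReal_norm]
    exact ENNReal.continuous_ofReal.comp hω
  have h0 : (0 : ℝ≥0∞) = ∫⁻ x : X d, 0 := by simp
  rw [h0]
  refine tendsto_lintegral_filter_of_dominated_convergence
    (fun k => (‖bumpHat d k‖ₑ * (2 * ‖A‖ₑ)) ^ p) (Eventually.of_forall fun t => ?_)
    (Eventually.of_forall fun t => Eventually.of_forall fun k => ?_) ?_
    (Eventually.of_forall fun k => ?_)
  · refine Measurable.pow_const (Measurable.mul (M := ℝ≥0∞) ?_ ?_) p
    · exact (bumpHat d).continuous.enorm.measurable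
    · exact (hω'.comp (continuous_const_smul _)).measurable
  · gcongr
    refine (enorm_sub_le ..).trans ?_
    rw [← ofReal_norm, ← ofReal_norm, norm_mul_expQ, norm_expQ_mul, ofReal_norm, two_mul]
  · simp_rw [mul_pow]
    rw [lintegral_mul_const' _ _ (by simp [ENNReal.mul_eq_top])]
    refine ENNReal.mul_ne_top ?_ (by simp [ENNReal.mul_eq_top])
    have h2 := ((bumpHat d).memLp (p : ℝ≥0∞) volume).eLpNorm_lt_top
    have h3 := lintegral_rpow_enorm_lt_top_of_eLpNorm_lt_top (by simpa using hp) (by simp) h2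
    simpa using h3.ne
  · have h1 : Tendsto (fun t : ℝ => (2 * Real.pi * t) • k) (𝓝 0) (𝓝 0) := by
      have : Continuous fun t : ℝ => (2 * Real.pi * t) • k := by fun_prop
      simpa using this.tendsto 0
    have h2 := (hω'.tendsto 0).comp h1
    have h3 := ENNReal.Tendsto.pow (n := p)
      (ENNReal.Tendsto.const_mul h2 (a := ‖bumpHat d k‖ₑ) (Or.inr (by simp)))
    have h4 : ‖A * expQ (0 : X d) - expQ 0 * A‖ₑ = 0 := by
      rw [expQ_zero, mul_one, one_mul, sub_self, ← ofReal_norm, norm_zero, ENNReal.ofReal_zero]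
    rw [h4, mul_zero, zero_pow hp] at h3
    exact h3

theorem enorm_commutator_loc_le (A : Op d) (t : ℝ) :
    ‖A * mulOp (loc t 0) - mulOp (loc t 0) * A‖ₑ ≤ slowModulus A 1 t := by
  refine ContinuousLinearMap.opENorm_le_bound _ fun u => ?_
  have hi : ∀ v : L2 d, Integrable fun k => (bumpHat d k * Complex.exp (-(2 * Real.pi *
      inner ℝ k (0 : X d)) * Complex.I)) • expQ ((2 * Real.pi * t) • k) v := fun v => by
    simpa using integrable_smul_expQ (bumpHat d).integrable _ v
  rw [sub_apply, mul_apply_eq_comp, mul_apply_eq_comp, mulOp_loc_apply, mulOp_loc_apply,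
    ← ContinuousLinearMap.integral_comp_comm _ (hi u),
    ← integral_sub (A.integrable_comp (hi u)) (hi (A u))]
  refine (enorm_integral_le_lintegral_enorm _).trans ?_
  rw [slowModulus, ← lintegral_mul_const' _ _ (by simp)]
  refine lintegral_mono fun k => ?_
  rw [map_smul, ← smul_sub, enorm_smul, pow_one, mul_assoc ‖bumpHat d k‖ₑ]
  simp only [inner_zero_right, Complex.ofReal_zero, mul_zero, neg_zero, zero_mul, Complex.exp_zero,
    mul_one]
  refine mul_le_mul_right ?_ _
  exact ContinuousLinearMap.le_opENorm (A * expQ ((2 * Real.pi * t) • k) -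
    expQ ((2 * Real.pi * t) • k) * A) u

/-! ### Finite rank operators -/

/-- The orthogonal projection onto the span of a finite ε-net is at least as good an approximation
as the nearest point of the net. -/
theorem exists_orthonormal_approx {H : Type*} [NormedAddCommGroup H] [InnerProductSpace ℂ H]
    {K : Set H} (hK : IsCompact K) {ε : ℝ} (hε : 0 < ε) :
    ∃ (n : ℕ) (e : Fin n → H), ∀ x ∈ K, ‖x - ∑ i, inner ℂ (e i) x • e i‖ ≤ ε := by
  obtain ⟨s, -, hs, hsK⟩ := hK.finite_cover_balls hε
  let V := Submodule.span ℂ s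
  have : FiniteDimensional ℂ V := FiniteDimensional.span_of_finite ℂ hs
  let b := stdOrthonormalBasis ℂ V
  refine ⟨_, fun i => (b i : H), fun x hx => ?_⟩
  have h1 : ∑ i, inner ℂ (b i : H) x • (b i : H) = V.starProjection x := by
    rw [b.starProjection_eq_sum_rankOne]
    simp
  obtain ⟨y, hy, hxy⟩ := Set.mem_iUnion₂.mp (hsK hx)
  rw [h1, Submodule.starProjection_minimal]
  refine (ciInf_le ⟨0, Set.forall_mem_range.mpr fun _ => norm_nonneg _⟩
    (⟨y, Submodule.subset_span hy⟩ : V)).trans ?_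
  rw [← dist_eq_norm]
  exact (Metric.mem_ball.mp hxy).le

/-- The finite rank operator `u ↦ ∑ ⟨a i, u⟩ b i`. -/
def finRank {H : Type*} [NormedAddCommGroup H] [InnerProductSpace ℂ H] {n : ℕ}
    (a b : Fin n → H) : H →L[ℂ] H :=
  ∑ i, InnerProductSpace.rankOne ℂ (b i) (a i)

section FiniteRank
variable {H : Type*} [NormedAddCommGroup H] [InnerProductSpace ℂ H] {n : ℕ}

theorem finRank_apply (a b : Fin n → H) (u : H) :
    finRank a b u = ∑ i, inner ℂ (a i) u • b i := by
  simp [finRank]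

theorem isCompactOperator_finRank (a b : Fin n → H) : IsCompactOperator (finRank a b) := by
  let S : H →L[ℂ] (Fin n → ℂ) := ContinuousLinearMap.pi fun i => innerSL ℂ (a i)
  let T : (Fin n → ℂ) →L[ℂ] H :=
    ∑ i, (ContinuousLinearMap.proj (R := ℂ) (φ := fun _ : Fin n => ℂ) i).smulRight (b i)
  have h : finRank a b = T ∘L S := by
    ext u
    simp [finRank_apply, S, T]
  rw [h]
  exact (isCompactOperator_of_locallyCompactSpace_rng T).comp_clm S

theorem adjoint_finRank [CompleteSpace H] (a b : Fin n → H) :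
    ContinuousLinearMap.adjoint (finRank a b) = finRank b a := by
  simp [finRank, map_sum]

end FiniteRank

/-! ### Local averages -/

variable (d) in
/-- The normalized indicator function of the ball of radius `r`. -/
def ballAverage (r : ℝ) : L2 d :=
  indicatorConstLp 2 (measurableSet_ball (x := (0 : X d)) (ε := r)) measure_ball_lt_top.ne
    ((volume.real (Metric.ball (0 : X d) r))⁻¹ : ℂ)

theorem inner_ballAverage (r : ℝ) (x : X d) (v : L2 d) :
    inner ℂ (expP (-x) (ballAverage d r)) v =
      ∫ a, v (x + a) ∂(ProbabilityTheory.cond volume (Metric.ball (0 : X d) r)) := by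
  rw [← adjoint_expP, ContinuousLinearMap.adjoint_inner_left, ballAverage,
    L2.inner_indicatorConstLp_eq_inner_setIntegral, RCLike.inner_apply,
    ProbabilityTheory.cond, integral_smul_measure]
  have : ∫ a in Metric.ball (0 : X d) r, expP x v a =
      ∫ a in Metric.ball (0 : X d) r, v (x + a) := by
    refine integral_congr_ae (ae_restrict_of_ae ?_)
    filter_upwards [expP_apply_ae x v] with a ha
    rw [ha, add_comm]
  rw [this, map_inv₀, Complex.conj_ofReal, ENNReal.toReal_inv, Complex.real_smul]
  push_cast
  rw [mul_comm]; rfl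

theorem enorm_integral_sq_le {α : Type*} [MeasurableSpace α] {μ : Measure α}
    [IsProbabilityMeasure μ] {f : α → ℂ} (hf : AEStronglyMeasurable f μ) :
    ‖∫ a, f a ∂μ‖ₑ ^ 2 ≤ ∫⁻ a, ‖f a‖ₑ ^ 2 ∂μ := by
  have h1 : ‖∫ a, f a ∂μ‖ₑ ≤ eLpNorm f 1 μ := by
    rw [eLpNorm_one_eq_lintegral_enorm]
    exact enorm_integral_le_lintegral_enorm f
  have h2 := h1.trans (eLpNorm_le_eLpNorm_of_exponent_le (q := 2) (by norm_num) hf)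
  exact (pow_le_pow_left' h2 2).trans_eq (eLpNorm_two_sq f)

/-- The difference between `v` and its ball average is a mean of `v - expP a v` over small `a`;
Jensen's inequality and Tonelli conclude. -/
theorem lintegral_sub_ballAverage_le {r : ℝ} (hr : 0 < r) {v : L2 d} {c : ℝ≥0∞}
    (hc : ∀ a : X d, ‖a‖ < r → ‖expP a v - v‖ₑ ≤ c) :
    ∫⁻ x, ‖v x - inner ℂ (expP (-x) (ballAverage d r)) v‖ₑ ^ 2 ≤ c ^ 2 := by
  set μ := ProbabilityTheory.cond volume (Metric.ball (0 : X d) r) with hμ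
  have hprob : IsProbabilityMeasure μ :=
    ProbabilityTheory.cond_isProbabilityMeasure_of_finite
      (Metric.measure_ball_pos volume _ hr).ne' measure_ball_lt_top.ne
  have hv : Measurable (v : X d → ℂ) := (Lp.stronglyMeasurable v).measurable
  have hint : ∀ x : X d, Integrable (fun a => v (x + a)) μ := fun x => by
    refine Integrable.smul_measure ?_ (ENNReal.inv_ne_top.mpr
      (Metric.measure_ball_pos volume _ hr).ne')
    have h := integrableOn_Lp_of_measure_ne_top (s := Metric.ball (0 : X d) r) (expP x v)
      (by norm_num) measure_ball_lt_top.ne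
    refine h.congr (ae_restrict_of_ae ?_)
    filter_upwards [expP_apply_ae x v] with a ha
    rw [ha, add_comm]
  calc _ ≤ ∫⁻ x, ∫⁻ a, ‖v x - v (x + a)‖ₑ ^ 2 ∂μ := by
        refine lintegral_mono fun x => ?_
        have h1 : v x - inner ℂ (expP (-x) (ballAverage d r)) v = ∫ a, (v x - v (x + a)) ∂μ := by
          rw [integral_sub (integrable_const _) (hint x), inner_ballAverage, integral_const]
          simp [μ]
        rw [h1]
        exact enorm_integral_sq_le (aestronglyMeasurable_const.sub (hint x).1)
    _ = ∫⁻ a, (∫⁻ x, ‖v x - v (x + a)‖ₑ ^ 2) ∂μ := by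
        refine lintegral_lintegral_swap (Measurable.aemeasurable ?_)
        fun_prop
    _ ≤ ∫⁻ a, c ^ 2 ∂μ := by
        refine lintegral_mono_ae ?_
        have hb : ∀ᵐ a ∂μ, a ∈ Metric.ball (0 : X d) r :=
          ProbabilityTheory.ae_cond_mem measurableSet_ball
        filter_upwards [hb] with a ha
        refine le_trans (le_of_eq ?_) (pow_le_pow_left' (hc a (by simpa using ha)) 2)
        rw [enorm_sq_eq_lintegral]
        refine lintegral_congr_ae ?_
        filter_upwards [expP_apply_ae a v, Lp.coeFn_sub (expP a v) v] with x h1 h2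
        rw [h2, Pi.sub_apply, h1, ← enorm_neg, neg_sub]
    _ = c ^ 2 := by simp

/-! ### The Riesz–Kolmogorov theorem -/

/-- A quantitative Riesz–Kolmogorov theorem with a finite rank operator independent of `v`. On the
support of `θ`, the vector is replaced by its ball averages `⟨g x, v⟩`. The vectors `g x` run over a
compact subset of L², so they can be projected onto a finite-dimensional space. -/
theorem exists_finRank_approx (θ : X d →ᵇ ℂ) (hθ : HasCompactSupport θ) {r : ℝ} (hr : 0 < r)
    {ε : ℝ} (hε : 0 < ε) :
    ∃ (n : ℕ) (e b : Fin n → L2 d), ∀ (v : L2 d) (c : ℝ), 0 ≤ c →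
      (∀ a : X d, ‖a‖ < r → ‖expP a v - v‖ ≤ c) →
      ‖mulOp θ v - finRank e b v‖ ≤ ‖θ‖ * c + ε * ‖v‖ := by
  set g : X d → L2 d := fun x => expP (-x) (ballAverage d r) with hg
  have hgc : Continuous g := (continuous_expP_apply _).comp continuous_neg
  set K := tsupport θ with hK
  have hKc : IsCompact K := hθ
  set V := volume.real K with hV
  -- The projection error costs `‖θ‖ * δ * √V` in L² norm, relative to `‖v‖`; adding 1 to each
  -- factor avoids division by zero.
  set δ : ℝ := ε / ((‖θ‖ + 1) * (√V + 1)) with hδ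
  have hδ0 : 0 < δ := by positivity
  obtain ⟨n, e, he⟩ := exists_orthonormal_approx (hKc.image hgc) hδ0
  have hcont : ∀ i, Continuous fun x => θ x * inner ℂ (g x) (e i) := fun i =>
    θ.continuous.mul (hgc.inner continuous_const)
  have hmem : ∀ i, MemLp (fun x => θ x * inner ℂ (g x) (e i)) 2 volume := fun i =>
    (hcont i).memLp_of_hasCompactSupport hθ.mul_right
  refine ⟨n, e, fun i => (hmem i).toLp _, fun v c hc hv => ?_⟩
  have hF : finRank e (fun i => (hmem i).toLp _) v =ᵐ[volume]
      fun x => θ x * inner ℂ (∑ i, inner ℂ (e i) (g x) • e i) v := by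
    rw [finRank_apply]
    have h1 : ∀ᵐ x, ∀ i, ((hmem i).toLp _ : X d → ℂ) x = θ x * inner ℂ (g x) (e i) :=
      ae_all_iff.mpr fun i => (hmem i).coeFn_toLp
    have h2 : ∀ᵐ x, ∀ i, (inner ℂ (e i) v • (hmem i).toLp _ : L2 d) x =
        inner ℂ (e i) v * ((hmem i).toLp _ : X d → ℂ) x :=
      ae_all_iff.mpr fun i => Lp.coeFn_smul _ _
    filter_upwards [h1, h2, Lp.coeFn_finsetSum Finset.univ
      (fun i => inner ℂ (e i) v • (hmem i).toLp _)] with x h1 h2 h3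
    rw [h3, sum_inner, Finset.mul_sum, Finset.sum_apply]
    refine Finset.sum_congr rfl fun i _ => ?_
    rw [h2, h1, inner_smul_left, inner_conj_symm]
    ring
  -- `p` is the error of averaging, `q` that of projecting the averaging vectors.
  set p : X d → ℂ := fun x => θ x * (v x - inner ℂ (g x) v) with hp
  set q : X d → ℂ := fun x => θ x * inner ℂ (g x - ∑ i, inner ℂ (e i) (g x) • e i) v with hq
  have hpm : AEStronglyMeasurable p volume := θ.continuous.aestronglyMeasurable.mul
    ((Lp.aestronglyMeasurable v).sub (hgc.inner continuous_const).aestronglyMeasurable)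
  have hqm : AEStronglyMeasurable q volume := by
    apply Continuous.aestronglyMeasurable
    fun_prop
  have hpq : (mulOp θ v - finRank e (fun i => (hmem i).toLp _) v : L2 d) =ᵐ[volume] p + q := by
    filter_upwards [hF, mulOp_apply_ae θ v,
      Lp.coeFn_sub (mulOp θ v) (finRank e (fun i => (hmem i).toLp _) v)] with x h1 h2 h3
    rw [h3, Pi.sub_apply, h1, h2, Pi.add_apply, hp, hq]
    simp only [inner_sub_left]
    ring
  have hp2 : eLpNorm p 2 ≤ ENNReal.ofReal (‖θ‖ * c) := by
    rw [ENNReal.ofReal_mul (norm_nonneg _)]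
    refine (eLpNorm_le_mul_eLpNorm_of_ae_le_mul (g := fun x => v x - inner ℂ (g x) v) (c := ‖θ‖)
      (Eventually.of_forall fun x => ?_) 2).trans ?_
    · rw [hp, norm_mul]
      exact mul_le_mul_of_nonneg_right (θ.norm_coe_le_norm x) (norm_nonneg _)
    · refine mul_le_mul_right (le_of_sq_le_sq ?_) _
      rw [eLpNorm_two_sq]
      refine lintegral_sub_ballAverage_le hr fun a ha => ?_
      rw [← ofReal_norm]
      exact ENNReal.ofReal_le_ofReal (hv a ha)
  have hq2 : eLpNorm q 2 ≤ ENNReal.ofReal (ε * ‖v‖) := by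
    refine le_of_sq_le_sq ?_
    rw [eLpNorm_two_sq]
    calc ∫⁻ x, ‖q x‖ₑ ^ 2 ≤ ∫⁻ x, K.indicator (fun _ => ENNReal.ofReal (‖θ‖ * (δ * ‖v‖)) ^ 2) x := by
          refine lintegral_mono fun x => ?_
          by_cases hx : x ∈ K
          · rw [Set.indicator_of_mem hx, ← ofReal_norm]
            refine pow_le_pow_left' (ENNReal.ofReal_le_ofReal ?_) 2
            rw [hq, norm_mul]
            refine mul_le_mul (θ.norm_coe_le_norm x) ((norm_inner_le_norm _ _).trans ?_)
              (norm_nonneg _) (norm_nonneg _)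
            exact mul_le_mul_of_nonneg_right (he _ ⟨x, hx, rfl⟩) (norm_nonneg _)
          · rw [hq]
            simp [image_eq_zero_of_notMem_tsupport hx]
      _ = ENNReal.ofReal (‖θ‖ * (δ * ‖v‖)) ^ 2 * ENNReal.ofReal (√V) ^ 2 := by
          rw [lintegral_indicator_const hKc.measurableSet, ← ENNReal.ofReal_pow (Real.sqrt_nonneg _),
            Real.sq_sqrt measureReal_nonneg, ofReal_measureReal hKc.measure_ne_top]
      _ ≤ _ := by
          rw [← mul_pow, ← ENNReal.ofReal_mul (by positivity)]
          refine pow_le_pow_left' (ENNReal.ofReal_le_ofReal ?_) 2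
          have h1 : ‖θ‖ * (δ * ‖v‖) * √V = (ε * ‖v‖) * ((‖θ‖ * √V) / ((‖θ‖ + 1) * (√V + 1))) := by
            rw [hδ]; ring
          rw [h1]
          refine mul_le_of_le_one_right (by positivity) ?_
          rw [div_le_one (by positivity)]
          gcongr <;> linarith
  rw [← ENNReal.ofReal_le_ofReal_iff (by positivity), ENNReal.ofReal_add (by positivity)
    (by positivity), ofReal_norm, Lp.enorm_def, eLpNorm_congr_ae hpq]
  exact (eLpNorm_add_le hpm hqm (by norm_num)).trans (add_le_add hp2 hq2)

/-! ### Cut-offs -/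

theorem norm_one_sub_bump_le (x : X d) : ‖1 - bump d x‖ ≤ 1 := by
  rw [bump_apply, ← Complex.ofReal_one, ← Complex.ofReal_sub, Complex.norm_real,
    Real.norm_of_nonneg (sub_nonneg.mpr (bumpBase d).le_one)]
  linarith [(bumpBase d).nonneg' x]

theorem loc_zero_eq_one {t : ℝ} {x : X d} (ht : 0 ≤ t) (h : t * ‖x‖ ≤ 1) : loc t 0 x = 1 := by
  rw [loc_apply, sub_zero]
  exact bump_eq_one (by rwa [norm_smul, Real.norm_of_nonneg ht])

theorem hasCompactSupport_loc {t : ℝ} (ht : 0 < t) (z : X d) : HasCompactSupport (loc t z) := by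
  refine HasCompactSupport.intro (isCompact_closedBall (t⁻¹ • z) (2 / t)) fun x hx => ?_
  rw [loc_apply]
  refine bump_eq_zero ?_
  rw [Metric.mem_closedBall, not_le, dist_eq_norm, div_lt_iff₀ ht] at hx
  have h : t • x - z = t • (x - t⁻¹ • z) := by
    rw [smul_sub, smul_smul, mul_inv_cancel₀ ht.ne', one_smul]
  rw [h, norm_smul, Real.norm_of_nonneg ht.le, mul_comm]
  exact hx.le

theorem hasCompactSupport_mul_loc (θ : X d →ᵇ ℂ) {t : ℝ} (ht : 0 < t) (z : X d) :
    HasCompactSupport (θ * loc t z) := by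
  refine HasCompactSupport.intro (hasCompactSupport_loc ht z) fun x hx => ?_
  rw [BoundedContinuousFunction.mul_apply, image_eq_zero_of_notMem_tsupport hx, mul_zero]

theorem tendsto_mulOp_loc_apply (u : L2 d) :
    Tendsto (fun t : ℝ => mulOp (loc t 0) u) (𝓝 0) (𝓝 u) := by
  rw [tendsto_iff_edist_tendsto_0]
  have key : ∀ t : ℝ, edist (mulOp (loc t 0) u) u ^ 2 =
      ∫⁻ x, (‖1 - bump d (t • x)‖ₑ * ‖u x‖ₑ) ^ 2 := fun t => by
    rw [edist_eq_enorm_sub, enorm_sq_eq_lintegral]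
    refine lintegral_congr_ae ?_
    filter_upwards [mulOp_apply_ae (loc t 0) u, Lp.coeFn_sub (mulOp (loc t 0) u) u] with x h1 h2
    rw [h2, Pi.sub_apply, h1, loc_apply, sub_zero, ← enorm_mul, ← enorm_neg]
    congr 2
    ring
  refine tendsto_zero_of_sq ?_
  simp_rw [key]
  have h0 : (0 : ℝ≥0∞) = ∫⁻ x : X d, 0 := by simp
  rw [h0]
  refine tendsto_lintegral_filter_of_dominated_convergence (fun x => ‖u x‖ₑ ^ 2)
    (Eventually.of_forall fun t => ?_) (Eventually.of_forall fun t => Eventually.of_forall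
      fun x => ?_) ?_ (Eventually.of_forall fun x => ?_)
  · have h1 : Measurable (u : X d → ℂ) := (Lp.stronglyMeasurable u).measurable
    have h2 : Measurable fun x : X d => 1 - bump d (t • x) := by
      apply Continuous.measurable
      exact continuous_const.sub ((bump d).continuous.comp (continuous_const_smul t))
    fun_prop
  · refine pow_le_pow_left' (mul_le_of_le_one_left' ?_) 2
    rw [← ofReal_norm, ← ENNReal.ofReal_one]
    exact ENNReal.ofReal_le_ofReal (norm_one_sub_bump_le _)
  · rw [← enorm_sq_eq_lintegral]
    simp
  · have hc : Tendsto (fun t : ℝ => ‖1 - bump d (t • x)‖ₑ) (𝓝 0) (𝓝 0) := by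
      have h : Continuous fun t : ℝ => ‖1 - bump d (t • x)‖ₑ :=
        (continuous_const.sub ((bump d).continuous.comp (by fun_prop))).enorm
      simpa [bump_eq_one] using h.tendsto 0
    simpa using ENNReal.Tendsto.pow (n := 2)
      (ENNReal.Tendsto.mul_const hc (b := ‖u x‖ₑ) (Or.inr (by simp)))

theorem exists_norm_mul_loc_sub_le (θ : C₀(X d, ℂ)) {ε : ℝ} (hε : 0 < ε) :
    ∃ t : ℝ, 0 < t ∧ ‖θ.toBCF * loc t 0 - θ.toBCF‖ ≤ ε := by
  have h := θ.zero_at_infty'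
  rw [← Metric.cobounded_eq_cocompact, Metric.tendsto_nhds] at h
  obtain ⟨r, hr⟩ := (Metric.hasBasis_cobounded_compl_closedBall (0 : X d)).eventually_iff.mp
    (h ε hε)
  refine ⟨(|r| + 1)⁻¹, by positivity, ?_⟩
  rw [BoundedContinuousFunction.norm_le hε.le]
  intro x
  rw [BoundedContinuousFunction.sub_apply, BoundedContinuousFunction.mul_apply]
  by_cases hx : x ∈ Metric.closedBall (0 : X d) r
  · rw [loc_zero_eq_one (by positivity), mul_one, sub_self, norm_zero]
    · exact hε.le
    · rw [mem_closedBall_zero_iff] at hx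
      rw [inv_mul_le_one₀ (by positivity)]
      linarith [le_abs_self r]
  · have h1 := hr.2 hx
    rw [dist_zero_right] at h1
    have h2 : θ.toBCF x * loc (|r| + 1)⁻¹ 0 x - θ.toBCF x =
        -(θ.toBCF x * (1 - bump d ((|r| + 1)⁻¹ • x))) := by
      rw [loc_apply, sub_zero]; ring
    rw [h2, norm_neg, norm_mul]
    refine (mul_le_of_le_one_right (norm_nonneg _) (norm_one_sub_bump_le _)).trans ?_
    exact h1.le

variable (d) in
/-- A strictly positive function vanishing at infinity. -/
def weight : C₀(X d, ℂ) where
  toFun x := ((1 + ‖x‖)⁻¹ : ℝ)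
  continuous_toFun := by
    refine Complex.continuous_ofReal.comp (Continuous.inv₀ (by fun_prop) fun x => ?_)
    positivity
  zero_at_infty' := by
    rw [← Complex.ofReal_zero]
    refine (Complex.continuous_ofReal.tendsto 0).comp (tendsto_inv_atTop_zero.comp ?_)
    exact tendsto_atTop_add_const_left _ _ (tendsto_norm_cocompact_atTop)

theorem weight_apply (x : X d) : (weight d).toBCF x = ((1 + ‖x‖)⁻¹ : ℝ) := rfl

theorem norm_weight_le : ‖(weight d).toBCF‖ ≤ 1 := by
  rw [BoundedContinuousFunction.norm_le zero_le_one]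
  intro x
  rw [weight_apply, Complex.norm_real, Real.norm_of_nonneg (by positivity)]
  exact inv_le_one_of_one_le₀ (by linarith [norm_nonneg x])

theorem exists_eq_weight_mul (θ : X d →ᵇ ℂ) (hθ : HasCompactSupport θ) :
    ∃ g : X d →ᵇ ℂ, θ = (weight d).toBCF * g := by
  have hc : Continuous fun x : X d => ((1 + ‖x‖ : ℝ) : ℂ) * θ x := by fun_prop
  obtain ⟨C, hC⟩ := hc.bounded_above_of_compact_support hθ.mul_left
  refine ⟨BoundedContinuousFunction.ofNormedAddCommGroup _ hc C hC, ?_⟩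
  ext x
  have : ((1 + ‖x‖ : ℝ) : ℂ) ≠ 0 := by
    rw [Complex.ofReal_ne_zero]; positivity
  rw [BoundedContinuousFunction.mul_apply, weight_apply,
    BoundedContinuousFunction.coe_ofNormedAddCommGroup, ← mul_assoc, Complex.ofReal_inv,
    inv_mul_cancel₀ this, one_mul]

/-- On bounded sets of operators the seminorm of `weight` controls all the others: cut `θ` off far
away, divide by the weight, and absorb the small tail with the norm bound. -/
theorem exists_norm_mul_mulOp_le (θ : C₀(X d, ℂ)) (M : ℝ) {ε : ℝ} (hε : 0 < ε) :
    ∃ K : ℝ, 0 ≤ K ∧ ∀ C : Op d, ‖C‖ ≤ M →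
      ‖C * mulOp θ.toBCF‖ ≤ K * ‖C * mulOp (weight d).toBCF‖ + ε := by
  obtain ⟨t, ht, h⟩ := exists_norm_mul_loc_sub_le θ (ε := ε / (|M| + 1)) (by positivity)
  obtain ⟨g, hg⟩ := exists_eq_weight_mul (θ.toBCF * loc t 0) (hasCompactSupport_mul_loc _ ht 0)
  refine ⟨‖g‖, norm_nonneg _, fun C hC => ?_⟩
  have h1 : C * mulOp θ.toBCF = C * mulOp (weight d).toBCF * mulOp g -
      C * mulOp (θ.toBCF * loc t 0 - θ.toBCF) := by
    rw [mulOp_sub, hg, mulOp_mul, mul_sub, mul_assoc, sub_sub_cancel]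
  rw [h1]
  refine (norm_sub_le _ _).trans (add_le_add ?_ ?_)
  · rw [mul_comm ‖g‖]
    exact (norm_mul_le _ _).trans (mul_le_mul_of_nonneg_left (norm_mulOp_le g) (norm_nonneg _))
  · refine (norm_mul_le _ _).trans ?_
    calc _ ≤ (|M| + 1) * (ε / (|M| + 1)) := by
          refine mul_le_mul (by linarith [le_abs_self M]) ((norm_mulOp_le _).trans h)
            (norm_nonneg _) (by positivity)
      _ = ε := by field_simp

theorem exists_norm_apply_le (u : L2 d) (M : ℝ) {ε : ℝ} (hε : 0 < ε) :
    ∃ K : ℝ, 0 ≤ K ∧ ∀ C : Op d, ‖C‖ ≤ M →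
      ‖C u‖ ≤ K * ‖C * mulOp (weight d).toBCF‖ + ε := by
  have h0 : ∀ᶠ t : ℝ in 𝓝[>] 0, ‖mulOp (loc t 0) u - u‖ < ε / (|M| + 1) := by
    have := (tendsto_iff_norm_sub_tendsto_zero.mp (tendsto_mulOp_loc_apply u)).mono_left
      (nhdsWithin_le_nhds (s := Set.Ioi 0))
    exact this.eventually (gt_mem_nhds (by positivity))
  obtain ⟨t, ht, ht0⟩ := (h0.and self_mem_nhdsWithin).exists
  obtain ⟨g, hg⟩ := exists_eq_weight_mul (loc t 0) (hasCompactSupport_loc ht0 0)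
  refine ⟨‖g‖ * ‖u‖, by positivity, fun C hC => ?_⟩
  have h1 : C u = (C * mulOp (weight d).toBCF) (mulOp g u) - C (mulOp (loc t 0) u - u) := by
    rw [map_sub, hg, mulOp_mul]
    simp
  rw [h1]
  refine (norm_sub_le _ _).trans (add_le_add ?_ ?_)
  · refine (ContinuousLinearMap.le_opNorm _ _).trans ?_
    rw [mul_comm]
    exact mul_le_mul_of_nonneg_right (norm_mulOp_apply_le g u) (norm_nonneg _)
  · refine (ContinuousLinearMap.le_opNorm _ _).trans ?_
    calc _ ≤ (|M| + 1) * (ε / (|M| + 1)) :=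
          mul_le_mul (by linarith [le_abs_self M]) ht.le (norm_nonneg _) (by positivity)
      _ = ε := by field_simp

/-! ### The local norm topology on bounded sets -/

theorem tendsto_toOp_symm_iff {ι : Type*} {l : Filter ι} {S : ι → Op d} {C : Op d} {M : ℝ}
    (hS : ∀ i, ‖S i‖ ≤ M) :
    Tendsto (fun i => LocOp.toOp.symm (S i)) l (𝓝 (LocOp.toOp.symm C)) ↔
      Tendsto (fun i => S i * mulOp (weight d).toBCF) l (𝓝 (C * mulOp (weight d).toBCF)) := by
  have hp : ∀ (θ : C₀(X d, ℂ)) i, localSeminormFamily d θ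
      (LocOp.toOp.symm (S i) - LocOp.toOp.symm C) = ‖(S i - C) * mulOp θ.toBCF‖ := fun θ i => rfl
  rw [withSeminorms_localSeminormFamily.tendsto_nhds, tendsto_iff_norm_sub_tendsto_zero]
  simp_rw [hp, ← sub_mul]
  constructor
  · intro h
    rw [Metric.tendsto_nhds]
    intro ε hε
    simpa using h (weight d) ε hε
  · intro h θ ε hε
    obtain ⟨K, hK, hθ⟩ := exists_norm_mul_mulOp_le θ (M + ‖C‖) (half_pos hε)
    have h2 := (h.const_mul K).eventually (gt_mem_nhds (show K * 0 < ε / 2 by simpa using hε))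
    filter_upwards [h2] with i hi
    refine (hθ _ ((norm_sub_le _ _).trans (add_le_add_left (hS i) _))).trans_lt ?_
    linarith

theorem tendsto_apply_of_tendsto_mul_weight {ι : Type*} {l : Filter ι} {S : ι → Op d} {C : Op d}
    {M : ℝ} (hS : ∀ i, ‖S i‖ ≤ M)
    (h : Tendsto (fun i => S i * mulOp (weight d).toBCF) l (𝓝 (C * mulOp (weight d).toBCF)))
    (u : L2 d) : Tendsto (fun i => S i u) l (𝓝 (C u)) := by
  rw [tendsto_iff_norm_sub_tendsto_zero] at h ⊢
  rw [Metric.tendsto_nhds]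
  intro ε hε
  obtain ⟨K, hK, hu⟩ := exists_norm_apply_le u (M + ‖C‖) (half_pos hε)
  have h2 := (h.const_mul K).eventually (gt_mem_nhds (show K * 0 < ε / 2 by simpa using hε))
  filter_upwards [h2] with i hi
  have h3 := hu (S i - C) ((norm_sub_le _ _).trans (add_le_add_left (hS i) _))
  rw [sub_mul, sub_apply] at h3
  rw [dist_zero_right, norm_norm]
  linarith

/-- On a bounded set, right multiplication by the weight induces the local norm topology, so
compactness can be tested in operator norm. -/
theorem isCompact_preimage_toOp_iff {S : Set (Op d)} {M : ℝ} (hS : ∀ B ∈ S, ‖B‖ ≤ M) :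
    IsCompact {B : LocOp d | LocOp.toOp B ∈ S} ↔
      IsCompact ((fun B => B * mulOp (weight d).toBCF) '' S) := by
  let Φ : {B : LocOp d | LocOp.toOp B ∈ S} → Op d :=
    fun B => LocOp.toOp B.1 * mulOp (weight d).toBCF
  have hΦ : IsInducing Φ := by
    rw [isInducing_iff_nhds]
    intro B
    have hiff := fun l : Filter {B : LocOp d | LocOp.toOp B ∈ S} =>
      tendsto_toOp_symm_iff (l := l) (S := fun B' => LocOp.toOp B'.1) (C := LocOp.toOp B.1)
        (fun B' => hS _ B'.2)
    rw [nhds_subtype_eq_comap]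
    refine le_antisymm ?_ ?_
    · rw [← tendsto_iff_comap]
      exact (hiff _).1 tendsto_comap
    · rw [← tendsto_iff_comap]
      exact (hiff _).2 tendsto_comap
  have hr : Set.range Φ = (fun B => B * mulOp (weight d).toBCF) '' S := by
    ext C
    constructor
    · rintro ⟨B, rfl⟩
      exact ⟨_, B.2, rfl⟩
    · rintro ⟨B, hB, rfl⟩
      exact ⟨⟨LocOp.toOp.symm B, hB⟩, rfl⟩
  rw [← hr, ← Set.image_univ, ← hΦ.isCompact_iff, isCompact_iff_isCompact_univ]

/-! ### Compactness of the classes of uniformly regular operators -/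

/-- `exists_finRank_approx` applied to the vectors `B v`: their modulus of continuity is controlled
by that of `A`, so one finite rank operator serves every `B`. -/
theorem exists_finRank_mul_approx (θ : X d →ᵇ ℂ) (hθ : HasCompactSupport θ) {A : Op d}
    (hA : Tendsto (fun a : X d => ‖(expP a - 1) * A‖) (𝓝 0) (𝓝 0)) {ε : ℝ} (hε : 0 < ε) :
    ∃ (n : ℕ) (e b : Fin n → L2 d), ∀ B : Op d, ‖B‖ ≤ ‖A‖ →
      (∀ a : X d, ‖(expP a - 1) * B‖ ≤ ‖(expP a - 1) * A‖) →
      ‖mulOp θ * B - finRank e b * B‖ ≤ ε := by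
  set δ := ε / (‖θ‖ + ‖A‖ + 1) with hδ
  have hδ0 : 0 < δ := by positivity
  obtain ⟨r, hr, hrA⟩ := Metric.eventually_nhds_iff.mp (hA.eventually (gt_mem_nhds hδ0))
  obtain ⟨n, e, b, h⟩ := exists_finRank_approx θ hθ hr hδ0
  refine ⟨n, e, b, fun B hB hBA => ContinuousLinearMap.opNorm_le_bound _ hε.le fun v => ?_⟩
  have h1 := h (B v) (δ * ‖v‖) (by positivity) fun a ha => ?_
  · rw [sub_apply, mul_apply_eq_comp, mul_apply_eq_comp]
    refine h1.trans ?_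
    calc ‖θ‖ * (δ * ‖v‖) + δ * ‖B v‖ ≤ ‖θ‖ * (δ * ‖v‖) + δ * (‖A‖ * ‖v‖) := by
          gcongr
          exact B.le_of_opNorm_le hB v
      _ = (δ * (‖θ‖ + ‖A‖)) * ‖v‖ := by ring
      _ ≤ ε * ‖v‖ := by
          gcongr
          rw [hδ, div_mul_eq_mul_div, div_le_iff₀ (by positivity)]
          exact mul_le_mul_of_nonneg_left (by linarith) hε.le
  · have h2 := ((expP a - 1) * B).le_of_opNorm_le
      ((hBA a).trans (hrA (y := a) (by simpa using ha)).le) v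
    simpa using h2

theorem totallyBounded_of_approx {E : Type*} [SeminormedAddCommGroup E] {S : Set E}
    (h : ∀ ε > 0, ∃ T : Set E, TotallyBounded T ∧ ∀ x ∈ S, ∃ y ∈ T, ‖x - y‖ ≤ ε) :
    TotallyBounded S := by
  rw [Metric.totallyBounded_iff]
  intro ε hε
  obtain ⟨T, hT, hST⟩ := h (ε / 2) (half_pos hε)
  obtain ⟨t, ht, hTt⟩ := Metric.totallyBounded_iff.mp hT (ε / 2) (half_pos hε)
  refine ⟨t, ht, fun x hx => ?_⟩
  obtain ⟨y, hy, hxy⟩ := hST x hx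
  obtain ⟨z, hz, hyz⟩ := Set.mem_iUnion₂.mp (hTt hy)
  refine Set.mem_iUnion₂.mpr ⟨z, hz, ?_⟩
  rw [Metric.mem_ball] at hyz ⊢
  rw [← dist_eq_norm] at hxy
  linarith [dist_triangle x y z]

/-- Such a product depends linearly and continuously on the finite matrix of coefficients `⟨e i, B
(b' j)⟩`, which stays in a fixed ball. -/
theorem totallyBounded_finRank_mul_mul {m n : ℕ} (e b : Fin m → L2 d) (e' b' : Fin n → L2 d)
    (M : ℝ) : TotallyBounded {C : Op d | ∃ B : Op d, ‖B‖ ≤ M ∧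
      C = finRank e b * B * finRank e' b'} := by
  let Ψ : (Fin m × Fin n → ℂ) → Op d :=
    fun c => ∑ p, c p • InnerProductSpace.rankOne ℂ (b p.1) (e' p.2)
  have hΨ : Continuous Ψ := by fun_prop
  set R := ∑ p : Fin m × Fin n, ‖e p.1‖ * (|M| * ‖b' p.2‖) with hR
  have hR0 : 0 ≤ R := by positivity
  refine (((isCompact_closedBall (0 : Fin m × Fin n → ℂ) R).image hΨ).totallyBounded).subset ?_
  rintro C ⟨B, hB, rfl⟩
  refine ⟨fun p => inner ℂ (e p.1) (B (b' p.2)), ?_, ?_⟩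
  · rw [mem_closedBall_zero_iff, pi_norm_le_iff_of_nonneg hR0]
    intro p
    refine (norm_inner_le_norm _ _).trans (le_trans ?_ (Finset.single_le_sum
      (f := fun p : Fin m × Fin n => ‖e p.1‖ * (|M| * ‖b' p.2‖)) (fun i _ => by positivity)
      (Finset.mem_univ p)))
    gcongr
    exact B.le_of_opNorm_le (hB.trans (le_abs_self M)) _
  · refine ContinuousLinearMap.ext fun u => ?_
    simp only [Ψ, mul_apply_eq_comp, finRank_apply, FunLike.coe_sum,
      Finset.sum_apply, smul_apply, InnerProductSpace.rankOne_apply, map_sum, map_smul,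
      Fintype.sum_prod_type, Finset.smul_sum, smul_smul]
    rw [Finset.sum_comm]
    refine Finset.sum_congr rfl fun i _ => Finset.sum_congr rfl fun j _ => ?_
    rw [mul_comm]

theorem slowModulus_one_le {A B : Op d} (hB : B ∈ regClass A) (t : ℝ) :
    slowModulus B 1 t ≤ slowModulus A 1 t := by
  refine lintegral_mono fun k => ?_
  rw [pow_one, pow_one]
  refine mul_le_mul_right ?_ _
  rw [← ofReal_norm, ← ofReal_norm]
  exact ENNReal.ofReal_le_ofReal (hB.2 _).2.2

theorem exists_loc_mul_eq (θ : X d →ᵇ ℂ) (hθ : HasCompactSupport θ) :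
    ∀ᶠ t in 𝓝[>] (0 : ℝ), loc t 0 * θ = θ := by
  obtain ⟨r, hr⟩ := (IsCompact.isBounded hθ).subset_closedBall (0 : X d)
  have h : ∀ᶠ t in 𝓝[>] (0 : ℝ), t < (|r| + 1)⁻¹ :=
    (gt_mem_nhds (by positivity)).filter_mono nhdsWithin_le_nhds
  filter_upwards [h, self_mem_nhdsWithin] with t ht ht0
  rw [Set.mem_Ioi] at ht0
  ext x
  rw [BoundedContinuousFunction.mul_apply]
  by_cases hx : x ∈ tsupport θ
  · rw [loc_zero_eq_one ht0.le, one_mul]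
    have h1 := mem_closedBall_zero_iff.mp (hr hx)
    calc t * ‖x‖ ≤ (|r| + 1)⁻¹ * (|r| + 1) := by
          gcongr
          linarith [le_abs_self r]
      _ = 1 := inv_mul_cancel₀ (by positivity)
  · rw [image_eq_zero_of_notMem_tsupport hx, mul_zero]

theorem totallyBounded_regClass_mul_weight {A : Op d} (hA : A ∈ ellipticAlgebra d) :
    TotallyBounded ((fun B => B * mulOp (weight d).toBCF) '' regClass A) := by
  refine totallyBounded_of_approx fun ε hε => ?_
  have hA' := mem_ellipticAlgebra_iff.mp hA
  set w := (weight d).toBCF with hw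
  -- Four errors follow: `‖A‖ * δ` for truncating the weight, and `δ` for each of the other three.
  set δ := ε / (‖A‖ + 4) with hδ
  have hδ0 : 0 < δ := by positivity
  obtain ⟨s, hs, hsw⟩ := exists_norm_mul_loc_sub_le (weight d) hδ0
  set θ := w * loc s 0 with hθ
  have hθc : HasCompactSupport θ := hasCompactSupport_mul_loc w hs 0
  have hθs : HasCompactSupport (star θ) :=
    HasCompactSupport.intro hθc fun x hx => by
      change star (θ x) = 0
      rw [image_eq_zero_of_notMem_tsupport hx, star_zero]
  -- Applied to adjoints, so that taking adjoints again approximates `B * mulOp θ` by `B * finRank b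
  -- e`.
  obtain ⟨n, e, b, h1⟩ := exists_finRank_mul_approx (star θ) hθs hA.2.1 hδ0
  have h2 : ∀ᶠ t in 𝓝[>] (0 : ℝ), slowModulus A 1 t < ENNReal.ofReal δ :=
    ((tendsto_slowModulus hA one_ne_zero).eventually
      (gt_mem_nhds (by simpa using hδ0))).filter_mono nhdsWithin_le_nhds
  obtain ⟨t, ⟨ht, htθ⟩, ht0⟩ :=
    ((h2.and (exists_loc_mul_eq θ hθc)).and self_mem_nhdsWithin).exists
  -- This error is later multiplied on the right by `finRank b e`, so that operator has to be fixed
  -- beforehand.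
  obtain ⟨m, e', b', h3⟩ := exists_finRank_mul_approx (loc t 0) (hasCompactSupport_loc ht0 0) hA.1
    (ε := δ / (‖finRank b e‖ + 1)) (by positivity)
  refine ⟨_, totallyBounded_finRank_mul_mul e' b' b e ‖A‖, ?_⟩
  rintro _ ⟨B, hB, rfl⟩
  refine ⟨_, ⟨B, hB.1, rfl⟩, ?_⟩
  have hBA : ∀ a : X d, ‖(expP a - 1) * ContinuousLinearMap.adjoint B‖ ≤
      ‖(expP a - 1) * ContinuousLinearMap.adjoint A‖ := fun a => by
    rw [norm_mul_expP_sub_one, norm_mul_expP_sub_one]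
    exact (hB.2 a).2.1
  have e1 : ‖B * mulOp w - B * mulOp θ‖ ≤ ‖A‖ * δ := by
    rw [← mul_sub, ← mulOp_sub]
    refine (norm_mul_le _ _).trans (mul_le_mul hB.1 ((norm_mulOp_le _).trans ?_)
      (norm_nonneg _) (norm_nonneg _))
    rw [norm_sub_rev]
    exact hsw
  have e2 : ‖B * mulOp θ - mulOp (loc t 0) * B * mulOp θ‖ ≤ δ := by
    have hcomm : ‖B * mulOp (loc t 0) - mulOp (loc t 0) * B‖ ≤ δ := by
      have := (enorm_commutator_loc_le B t).trans ((slowModulus_one_le hB t).trans ht.le)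
      rw [← ofReal_norm] at this
      exact (ENNReal.ofReal_le_ofReal_iff hδ0.le).mp this
    have : B * mulOp θ - mulOp (loc t 0) * B * mulOp θ =
        (B * mulOp (loc t 0) - mulOp (loc t 0) * B) * mulOp θ := by
      rw [sub_mul, mul_assoc B, ← mulOp_mul, htθ]
    rw [this]
    refine (norm_mul_le _ _).trans ?_
    refine (mul_le_of_le_one_right (norm_nonneg _) ((norm_mulOp_le _).trans ?_)).trans hcomm
    refine (norm_mul_le _ _).trans ?_
    exact mul_le_one₀ norm_weight_le (norm_nonneg _) (norm_loc_le _ _)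
  have e3 : ‖mulOp (loc t 0) * B * mulOp θ - mulOp (loc t 0) * B * finRank b e‖ ≤ δ := by
    have h4 := h1 _ (by simpa using hB.1) hBA
    rw [← LinearIsometryEquiv.norm_map ContinuousLinearMap.adjoint (_ - _), map_sub, adjoint_mul,
      adjoint_mul, adjoint_mulOp, star_star, ContinuousLinearMap.adjoint_adjoint,
      adjoint_finRank] at h4
    rw [mul_assoc, mul_assoc, ← mul_sub]
    refine (norm_mul_le _ _).trans ?_
    exact (mul_le_of_le_one_left (norm_nonneg _)
      ((norm_mulOp_le _).trans (norm_loc_le _ _))).trans h4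
  have e4 : ‖mulOp (loc t 0) * B * finRank b e - finRank e' b' * B * finRank b e‖ ≤ δ := by
    rw [← sub_mul]
    refine (norm_mul_le _ _).trans ?_
    calc _ ≤ δ / (‖finRank b e‖ + 1) * (‖finRank b e‖ + 1) := by
          gcongr
          · exact h3 B hB.1 fun a => (hB.2 a).1
          · linarith
      _ = δ := by field_simp
  have h5 : ‖A‖ * δ + 3 * δ ≤ ε := by
    have : (‖A‖ + 4) * δ = ε := by rw [hδ]; field_simp
    linarith
  have h6 := norm_sub_le_norm_sub_add_norm_sub (B * mulOp w) (B * mulOp θ)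
    (finRank e' b' * B * finRank b e)
  have h7 := norm_sub_le_norm_sub_add_norm_sub (B * mulOp θ) (mulOp (loc t 0) * B * mulOp θ)
    (finRank e' b' * B * finRank b e)
  have h8 := norm_sub_le_norm_sub_add_norm_sub (mulOp (loc t 0) * B * mulOp θ)
    (mulOp (loc t 0) * B * finRank b e) (finRank e' b' * B * finRank b e)
  linarith

/-- For a bounded sequence, norm convergence after multiplication by the weight forces strong
convergence; the strong limit is a bounded operator and stays in the class. -/
theorem isClosed_regClass_mul_weight (A : Op d) :
    IsClosed ((fun B => B * mulOp (weight d).toBCF) '' regClass A) := by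
  refine IsSeqClosed.isClosed fun S C hS hC => ?_
  choose B hB hBS using hS
  simp only at hBS
  have hCau : ∀ u, CauchySeq fun n => B n u := fun u => by
    rw [Metric.cauchySeq_iff]
    intro ε hε
    obtain ⟨K, hK, hu⟩ := exists_norm_apply_le u (‖A‖ + ‖A‖) (half_pos hε)
    obtain ⟨N, hN⟩ := Metric.cauchySeq_iff.mp hC.cauchySeq (ε / 2 / (K + 1)) (by positivity)
    refine ⟨N, fun m hm n hn => ?_⟩
    have h1 := hN m hm n hn
    rw [dist_eq_norm, ← hBS, ← hBS, ← sub_mul] at h1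
    have h2 := hu (B m - B n) ((norm_sub_le _ _).trans (add_le_add (hB m).1 (hB n).1))
    rw [dist_eq_norm, ← sub_apply]
    have h3 : (K + 1) * ‖(B m - B n) * mulOp (weight d).toBCF‖ < ε / 2 := by
      rwa [lt_div_iff₀ (by positivity), mul_comm] at h1
    nlinarith [norm_nonneg ((B m - B n) * mulOp (weight d).toBCF)]
  choose f hf using fun u => cauchySeq_tendsto_of_complete (hCau u)
  let T : Op d := continuousLinearMapOfTendsto B (f := f) (tendsto_pi_nhds.mpr hf)
  have hT : ∀ u, Tendsto (fun n => B n u) atTop (𝓝 (T u)) := hf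
  refine ⟨T, mem_regClass_of_strong_limit hB hT, ?_⟩
  refine ContinuousLinearMap.ext fun u => ?_
  refine tendsto_nhds_unique (hT (mulOp (weight d).toBCF u)) ?_
  have h1 : Tendsto (fun n => S n u) atTop (𝓝 (C u)) :=
    ((ContinuousLinearMap.apply ℂ (L2 d) u).continuous.tendsto C).comp hC
  refine h1.congr fun n => ?_
  rw [← hBS]; rfl

theorem isCompact_regClass_mul_weight {A : Op d} (hA : A ∈ ellipticAlgebra d) :
    IsCompact ((fun B => B * mulOp (weight d).toBCF) '' regClass A) :=
  isCompact_iff_totallyBounded_isComplete.mpr ⟨totallyBounded_regClass_mul_weight hA,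
    (isClosed_regClass_mul_weight A).isComplete⟩

theorem isCompact_inEllLoc_iff {S : Set (Op d)} (hS : S ⊆ ellipticAlgebra d) :
    IsCompact (inEllLoc S) ↔ IsCompact {B : LocOp d | LocOp.toOp B ∈ S} := by
  refine (IsInducing.subtypeVal (t := {A : LocOp d |
    LocOp.toOp A ∈ ellipticAlgebra d})).isCompact_iff.trans ?_
  have : Subtype.val '' inEllLoc S = {B : LocOp d | LocOp.toOp B ∈ S} := by
    ext B
    constructor
    · rintro ⟨B, hB, rfl⟩
      exact hB
    · intro hB
      exact ⟨⟨B, hS hB⟩, hB, rfl⟩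
  exact iff_of_eq (congrArg IsCompact this)

theorem isCompact_inEllLoc_regClass {A : Op d} (hA : A ∈ ellipticAlgebra d) :
    IsCompact (inEllLoc (regClass A)) := by
  rw [isCompact_inEllLoc_iff (regClass_subset_ellipticAlgebra hA),
    isCompact_preimage_toOp_iff (fun B hB => hB.1)]
  exact isCompact_regClass_mul_weight hA

theorem isCompact_closure_translates {A : Op d} (hA : A ∈ ellipticAlgebra d) :
    IsCompact (closure (inEllLoc (Set.range fun x : X d => translateOp x A))) := by
  -- A topological group is regular, so closures of subsets of compact sets are compact.
  have := (withSeminorms_localSeminormFamily (d := d)).topologicalAddGroup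
  refine (isCompact_inEllLoc_regClass hA).closure_of_subset ?_
  rintro B ⟨x, hx⟩
  change LocOp.toOp B.1 ∈ regClass A
  rw [← hx]
  exact translateOp_mem_regClass x A

/-! ### The operator spectrum -/

theorem mem_operatorSpectrum_iff {A B : Op d} : B ∈ operatorSpectrum A ↔
    ∃ x : ℕ → X d, Tendsto (fun n => ‖x n‖) atTop atTop ∧
      Tendsto (fun n => translateOp (x n) A * mulOp (weight d).toBCF) atTop
        (𝓝 (B * mulOp (weight d).toBCF)) := by
  refine exists_congr fun x => and_congr_right fun _ => ?_
  exact tendsto_toOp_symm_iff fun n => (norm_translateOp (x n) A).le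

theorem operatorSpectrum_subset_regClass (A : Op d) : operatorSpectrum A ⊆ regClass A := by
  intro B hB
  obtain ⟨x, -, hx⟩ := mem_operatorSpectrum_iff.mp hB
  exact mem_regClass_of_strong_limit (fun n => translateOp_mem_regClass (x n) A)
    (tendsto_apply_of_tendsto_mul_weight (fun n => (norm_translateOp (x n) A).le) hx)

theorem exists_subseq_translateOp {A : Op d} (hA : A ∈ ellipticAlgebra d) {x : ℕ → X d}
    (hx : Tendsto (fun n => ‖x n‖) atTop atTop) :
    ∃ B ∈ operatorSpectrum A, ∃ φ : ℕ → ℕ, StrictMono φ ∧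
      Tendsto (fun n => translateOp (x (φ n)) A * mulOp (weight d).toBCF) atTop
        (𝓝 (B * mulOp (weight d).toBCF)) := by
  obtain ⟨_, ⟨B, hB, rfl⟩, φ, hφ, h⟩ := (isCompact_regClass_mul_weight hA).tendsto_subseq
    fun n => ⟨translateOp (x n) A, translateOp_mem_regClass (x n) A, rfl⟩
  exact ⟨B, mem_operatorSpectrum_iff.mpr ⟨x ∘ φ, hx.comp hφ.tendsto_atTop, h⟩, φ, hφ, h⟩

theorem isCompact_operatorSpectrum_mul_weight {A : Op d} (hA : A ∈ ellipticAlgebra d) :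
    IsCompact ((fun B => B * mulOp (weight d).toBCF) '' operatorSpectrum A) := by
  refine (isCompact_regClass_mul_weight hA).of_isClosed_subset ?_
    (Set.image_mono (operatorSpectrum_subset_regClass A))
  refine IsSeqClosed.isClosed fun S C hS hC => ?_
  choose B hB hBS using hS
  simp only at hBS
  -- Diagonal choice: one far translate close to each limit operator of the sequence.
  have h1 : ∀ n : ℕ, ∃ x : X d, (n : ℝ) ≤ ‖x‖ ∧
      dist (translateOp x A * mulOp (weight d).toBCF) (S n) < 1 / ((n : ℝ) + 1) := fun n => by
    obtain ⟨x, hx, hxB⟩ := mem_operatorSpectrum_iff.mp (hB n)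
    rw [hBS] at hxB
    obtain ⟨k, h1, h2⟩ := ((hx.eventually_ge_atTop (n : ℝ)).and
      (Metric.tendsto_nhds.mp hxB _ (Nat.one_div_pos_of_nat (n := n)))).exists
    exact ⟨x k, h1, h2⟩
  choose x hx hxS using h1
  have hx' : Tendsto (fun n => ‖x n‖) atTop atTop :=
    tendsto_atTop_mono hx tendsto_natCast_atTop_atTop
  have hd : Tendsto (fun n => dist (translateOp (x n) A * mulOp (weight d).toBCF) (S n)) atTop
      (𝓝 0) := squeeze_zero (fun _ => dist_nonneg) (fun n => (hxS n).le)
    tendsto_one_div_add_atTop_nhds_zero_nat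
  have hlim : Tendsto (fun n => translateOp (x n) A * mulOp (weight d).toBCF) atTop (𝓝 C) := by
    rw [tendsto_iff_dist_tendsto_zero] at hC ⊢
    refine squeeze_zero (fun _ => dist_nonneg) (fun n => dist_triangle _ (S n) _) ?_
    simpa using hd.add hC
  obtain ⟨B', hB', φ, hφ, h⟩ := exists_subseq_translateOp hA hx'
  exact ⟨B', hB', tendsto_nhds_unique h (hlim.comp hφ.tendsto_atTop)⟩

theorem isCompact_inEllLoc_operatorSpectrum {A : Op d} (hA : A ∈ ellipticAlgebra d) :
    IsCompact (inEllLoc (operatorSpectrum A)) := by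
  rw [isCompact_inEllLoc_iff ((operatorSpectrum_subset_regClass A).trans
    (regClass_subset_ellipticAlgebra hA)),
    isCompact_preimage_toOp_iff (fun B hB => (operatorSpectrum_subset_regClass A hB).1)]
  exact isCompact_operatorSpectrum_mul_weight hA

/-- The adjoint is not continuous for the local norm topology. Compactness gives a limit `C` of the
translates of `A` along a subsequence, and matrix elements identify `C` with the adjoint of `B`. -/
theorem adjoint_mem_operatorSpectrum {A B : Op d} (hA : A ∈ ellipticAlgebra d)
    (hB : B ∈ operatorSpectrum (ContinuousLinearMap.adjoint A)) :
    ContinuousLinearMap.adjoint B ∈ operatorSpectrum A := by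
  obtain ⟨x, hx, hxB⟩ := mem_operatorSpectrum_iff.mp hB
  obtain ⟨C, hC, φ, hφ, h⟩ := exists_subseq_translateOp hA hx
  have hC' := tendsto_apply_of_tendsto_mul_weight (fun n => (norm_translateOp (x (φ n)) A).le) h
  have hB' := tendsto_apply_of_tendsto_mul_weight
    (fun n => (norm_translateOp (x n) (ContinuousLinearMap.adjoint A)).le) hxB
  suffices h : ContinuousLinearMap.adjoint B = C by rwa [h]
  symm
  rw [ContinuousLinearMap.eq_adjoint_iff]
  intro u v
  have h1 : Tendsto (fun n => inner ℂ (translateOp (x (φ n)) A u) v) atTop (𝓝 (inner ℂ (C u) v)) :=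
    (hC' u).inner tendsto_const_nhds
  have h2 : Tendsto (fun n => inner ℂ u (translateOp (x (φ n)) (ContinuousLinearMap.adjoint A) v))
      atTop (𝓝 (inner ℂ u (B v))) :=
    tendsto_const_nhds.inner ((hB' v).comp hφ.tendsto_atTop)
  refine tendsto_nhds_unique h1 (h2.congr fun n => ?_)
  rw [← adjoint_translateOp, ContinuousLinearMap.adjoint_inner_right]

/-! ### Estimates for Fredholm operators in Hilbert spaces -/

section Fredholm

variable {H : Type*} [NormedAddCommGroup H] [InnerProductSpace ℂ H] [CompleteSpace H]

/-- Along a subsequence `K (u n)` converges; the estimate applied to differences makes that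
subsequence Cauchy. -/
theorem exists_convergent_subseq {T K : H →L[ℂ] H} (hK : IsCompactOperator K) {C : ℝ}
    (h : ∀ u, ‖u‖ ≤ C * (‖T u‖ + ‖K u‖)) {u : ℕ → H} (hu : ∀ n, ‖u n‖ ≤ 1)
    (hT : CauchySeq fun n => T (u n)) :
    ∃ v, ∃ φ : ℕ → ℕ, StrictMono φ ∧ Tendsto (u ∘ φ) atTop (𝓝 v) := by
  obtain ⟨L, hL, hKL⟩ := hK.image_closedBall_subset_compact (f := (K : H →ₗ[ℂ] H)) 1
  obtain ⟨w, -, φ, hφ, hw⟩ := hL.tendsto_subseq (x := fun n => K (u n))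
    fun n => hKL ⟨u n, by simpa using hu n, rfl⟩
  have hT' := hT.comp_tendsto hφ.tendsto_atTop
  have hK' := hw.cauchySeq
  suffices hc : CauchySeq (u ∘ φ) by
    obtain ⟨v, hv⟩ := cauchySeq_tendsto_of_complete hc
    exact ⟨v, φ, hφ, hv⟩
  rw [Metric.cauchySeq_iff] at hT' hK' ⊢
  intro ε hε
  obtain ⟨N₁, h₁⟩ := hT' (ε / (2 * (|C| + 1))) (by positivity)
  obtain ⟨N₂, h₂⟩ := hK' (ε / (2 * (|C| + 1))) (by positivity)
  refine ⟨max N₁ N₂, fun m hm n hn => ?_⟩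
  have e₁ := h₁ m (le_of_max_le_left hm) n (le_of_max_le_left hn)
  have e₂ := h₂ m (le_of_max_le_right hm) n (le_of_max_le_right hn)
  have e₃ := h (u (φ m) - u (φ n))
  simp only [Function.comp, dist_eq_norm, ← map_sub] at e₁ e₂ ⊢
  rw [lt_div_iff₀ (by positivity)] at e₁ e₂
  nlinarith [le_abs_self C, norm_nonneg (T (u (φ m) - u (φ n))),
    norm_nonneg (K (u (φ m) - u (φ n)))]

theorem finiteDimensional_ker_of_estimate {T K : H →L[ℂ] H} (hK : IsCompactOperator K) {C : ℝ}
    (h : ∀ u, ‖u‖ ≤ C * (‖T u‖ + ‖K u‖)) : FiniteDimensional ℂ T.ker := by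
  refine FiniteDimensional.of_isCompact_closedBall ℂ zero_lt_one (c := (0 : T.ker))
    (IsSeqCompact.isCompact fun u hu => ?_)
  have hTu : ∀ n, T (u n) = 0 := fun n => (u n).2
  obtain ⟨v, φ, hφ, hv⟩ := exists_convergent_subseq hK h (u := fun n => (u n : H))
    (fun n => by simpa using hu n) (by simp_rw [hTu]; exact cauchySeq_const 0)
  have hTv : T v = 0 := by
    refine tendsto_nhds_unique ((T.continuous.tendsto v).comp hv) ?_
    simp only [Function.comp_def, hTu]
    exact tendsto_const_nhds
  have hv' : Tendsto (u ∘ φ) atTop (𝓝 (⟨v, hTv⟩ : T.ker)) := tendsto_subtype_rng.mpr hv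
  exact ⟨⟨v, hTv⟩, Metric.isClosed_closedBall.mem_of_tendsto hv'
    (Eventually.of_forall fun n => hu (φ n)), φ, hφ, hv'⟩

theorem exists_bound_on_orthogonal_ker {T K : H →L[ℂ] H} (hK : IsCompactOperator K) {C : ℝ}
    (h : ∀ u, ‖u‖ ≤ C * (‖T u‖ + ‖K u‖)) :
    ∃ c : ℝ, 0 ≤ c ∧ ∀ u ∈ T.kerᗮ, ‖u‖ ≤ c * ‖T u‖ := by
  by_contra! hcon
  have h1 : ∀ n : ℕ, ∃ u ∈ T.kerᗮ, ‖u‖ = 1 ∧ ‖T u‖ ≤ 1 / ((n : ℝ) + 1) := fun n => by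
    obtain ⟨u, hu, hn⟩ := hcon ((n : ℝ) + 1) (by positivity)
    have hu0 : 0 < ‖u‖ := lt_of_le_of_lt (by positivity) hn
    refine ⟨((‖u‖⁻¹ : ℝ) : ℂ) • u, Submodule.smul_mem _ _ hu, ?_, ?_⟩
    · rw [norm_smul, Complex.norm_real, norm_inv, norm_norm, inv_mul_cancel₀ hu0.ne']
    · rw [map_smul, norm_smul, Complex.norm_real, norm_inv, norm_norm, inv_mul_le_iff₀ hu0,
        mul_one_div, le_div_iff₀ (by positivity)]
      linarith
  choose u hu hu1 hTu using h1
  have hT0 : Tendsto (fun n => T (u n)) atTop (𝓝 0) :=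
    squeeze_zero_norm hTu tendsto_one_div_add_atTop_nhds_zero_nat
  obtain ⟨v, φ, hφ, hv⟩ := exists_convergent_subseq hK h (fun n => (hu1 n).le) hT0.cauchySeq
  have hTv : T v = 0 :=
    tendsto_nhds_unique ((T.continuous.tendsto v).comp hv) (hT0.comp hφ.tendsto_atTop)
  have hv1 : ‖v‖ = 1 := by
    refine tendsto_nhds_unique hv.norm ?_
    simp only [Function.comp_def, hu1]
    exact tendsto_const_nhds
  have hv2 : v ∈ T.kerᗮ := (Submodule.isClosed_orthogonal _).mem_of_tendsto hv
    (Eventually.of_forall fun n => hu (φ n))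
  have hv3 : inner ℂ v v = 0 := Submodule.inner_right_of_mem_orthogonal (K := T.ker) hTv hv2
  rw [inner_self_eq_zero] at hv3
  rw [hv3, norm_zero] at hv1
  exact zero_ne_one hv1

/-- The first estimate gives a finite-dimensional kernel and a lower bound on its complement, hence
closed range. The second bounds the kernel of the adjoint, which is the orthogonal complement of the
range. -/
theorem isFredholm_of_estimates {T K K' : H →L[ℂ] H} (hK : IsCompactOperator K)
    (hK' : IsCompactOperator K') {C C' : ℝ} (h : ∀ u, ‖u‖ ≤ C * (‖T u‖ + ‖K u‖))
    (h' : ∀ u, ‖u‖ ≤ C' * (‖ContinuousLinearMap.adjoint T u‖ + ‖K' u‖)) : T.IsFredholm := by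
  have hker := finiteDimensional_ker_of_estimate hK h
  have hker' := finiteDimensional_ker_of_estimate hK' h'
  obtain ⟨c, hc, hb⟩ := exists_bound_on_orthogonal_ker hK h
  have hcofg : (T.kerᗮ).CoFG :=
    Submodule.FG.cofg_of_isCompl (Submodule.isCompl_orthogonal _)
      (Submodule.fg_iff_finiteDimensional _ |>.mpr hker)
  have hanti : AntilipschitzWith (Real.toNNReal c) (T.domRestrict T.kerᗮ) :=
    ContinuousLinearMap.antilipschitz_of_bound _ fun u => by
      rw [Real.coe_toNNReal _ hc]
      exact hb u u.2
  have hemb := hanti.isClosedEmbedding (T.domRestrict T.kerᗮ).uniformContinuous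
  have hst : IsStrictMap T ∧ IsClosed (T.range : Set H) := by
    rw [T.isStrictMap_isClosed_range_iff_restrict T.kerᗮ (Submodule.isClosed_orthogonal _)]
    exact ⟨hemb.isEmbedding.isStrictMap, hemb.isClosed_range⟩
  refine ⟨hst.1, hst.2, hker, ?_, ?_⟩
  · have : CompleteSpace T.range := hst.2.completeSpace_coe
    refine Submodule.FG.cofg_of_isCompl
      (Submodule.isCompl_orthogonal T.range).symm ?_
    rw [ContinuousLinearMap.orthogonal_range]
    exact Submodule.fg_iff_finiteDimensional _ |>.mpr hker'
  · exact .of_finiteDimensional _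

theorem isUnit_of_estimates {T : H →L[ℂ] H} {C C' : ℝ} (h : ∀ u, ‖u‖ ≤ C * ‖T u‖)
    (h' : ∀ u, ‖u‖ ≤ C' * ‖ContinuousLinearMap.adjoint T u‖) : IsUnit T := by
  have hanti : AntilipschitzWith (Real.toNNReal C) T :=
    ContinuousLinearMap.antilipschitz_of_bound _ fun u =>
      (h u).trans (mul_le_mul_of_nonneg_right (Real.le_coe_toNNReal C) (norm_nonneg _))
  rw [ContinuousLinearMap.isUnit_iff_bijective,
    ContinuousLinearMap.bijective_iff_dense_range_and_antilipschitz]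
  refine ⟨?_, _, hanti⟩
  rw [Submodule.topologicalClosure_eq_top_iff, ContinuousLinearMap.orthogonal_range,
    LinearMap.ker_eq_bot']
  intro u hu
  have := h' u
  rw [ContinuousLinearMap.coe_coe] at hu
  rw [hu, norm_zero, mul_zero] at this
  exact norm_le_zero_iff.mp this

theorem exists_eq_finRank {P : H →L[ℂ] H} (hP : FiniteDimensional ℂ P.range) :
    ∃ (n : ℕ) (a b : Fin n → H), P = finRank a b := by
  let e := stdOrthonormalBasis ℂ P.range
  refine ⟨_, fun i => ContinuousLinearMap.adjoint P (e i : H), fun i => (e i : H), ?_⟩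
  refine ContinuousLinearMap.ext fun u => ?_
  have h1 : P.range.starProjection (P u) = P u :=
    Submodule.starProjection_eq_self_iff.mpr ⟨u, rfl⟩
  rw [← h1, e.starProjection_eq_sum_rankOne, finRank_apply]
  simp [ContinuousLinearMap.adjoint_inner_left]

/-- A quasi-inverse `S` inverts `T` modulo finite rank on both sides; the adjoint of the right-hand
relation gives the second bound. -/
theorem exists_estimates_of_isFredholm {T : H →L[ℂ] H} (hT : T.IsFredholm) :
    ∃ (C : ℝ) (n : ℕ) (a b : Fin n → H) (m : ℕ) (a' b' : Fin m → H),
      (∀ u, ‖u‖ ≤ C * ‖T u‖ + ‖finRank a b u‖) ∧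
      ∀ u, ‖u‖ ≤ C * ‖ContinuousLinearMap.adjoint T u‖ + ‖finRank a' b' u‖ := by
  obtain ⟨S, h1, h2⟩ := hT.exists_isQuasiInverse
  have f1 : FiniteDimensional ℂ (S * T - 1).range :=
    Module.Finite.iff_fg.mpr (LinearMap.HasNoetherianRange.hasFiniteRange
      (LinearMap.FiniteRangeSetoid.equiv_iff_hasNoetherianRange.mp h1))
  have f2 : FiniteDimensional ℂ (T * S - 1).range :=
    Module.Finite.iff_fg.mpr (LinearMap.HasNoetherianRange.hasFiniteRange
      (LinearMap.FiniteRangeSetoid.equiv_iff_hasNoetherianRange.mp h2))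
  obtain ⟨n, a, b, hab⟩ := exists_eq_finRank f1
  obtain ⟨m, a', b', hab'⟩ := exists_eq_finRank f2
  refine ⟨‖S‖, n, a, b, m, b', a', fun u => ?_, fun u => ?_⟩
  · have h3 : u = S (T u) - finRank a b u := by
      rw [← hab]; simp
    calc ‖u‖ = ‖S (T u) - finRank a b u‖ := by rw [← h3]
      _ ≤ _ := (norm_sub_le _ _).trans (add_le_add_left (S.le_opNorm _) _)
  · have h4 : ContinuousLinearMap.adjoint S * ContinuousLinearMap.adjoint T - 1 =
        finRank b' a' := by
      rw [← adjoint_finRank, ← hab', map_sub, ContinuousLinearMap.mul_def,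
        ContinuousLinearMap.mul_def, ContinuousLinearMap.adjoint_comp]
      congr 1
      exact ContinuousLinearMap.adjoint_id.symm
    have h3 : u = ContinuousLinearMap.adjoint S (ContinuousLinearMap.adjoint T u) -
        finRank b' a' u := by
      rw [← h4]; simp
    calc ‖u‖ = ‖ContinuousLinearMap.adjoint S (ContinuousLinearMap.adjoint T u) -
          finRank b' a' u‖ := by rw [← h3]
      _ ≤ _ := (norm_sub_le _ _).trans (add_le_add_left ?_ _)
    refine (ContinuousLinearMap.le_opNorm _ _).trans_eq ?_
    rw [LinearIsometryEquiv.norm_map]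

end Fredholm

/-! ### Translations to infinity -/

theorem star_loc (t : ℝ) (z : X d) : star (loc t z) = loc t z := by
  ext x
  rw [BoundedContinuousFunction.star_apply, loc_apply, bump_apply]
  exact Complex.conj_ofReal _

/-- Both factors vanish outside balls of radius `2 / t`, whose centres are `4 / t` or more apart. -/
theorem loc_mul_shift_loc {t : ℝ} (ht : 0 < t) {a : X d} (ha : 4 ≤ t * ‖a‖) :
    loc t 0 * shift a (loc t 0) = 0 := by
  ext x
  change _ = (0 : ℂ)
  rw [BoundedContinuousFunction.mul_apply, shift_apply, loc_apply, loc_apply, sub_zero, sub_zero,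
    mul_eq_zero]
  by_cases hx : 2 ≤ ‖t • x‖
  · exact Or.inl (bump_eq_zero hx)
  · refine Or.inr (bump_eq_zero ?_)
    have h : t • a = t • (x + a) - t • x := by rw [smul_add]; abel
    have h2 := norm_sub_le (t • (x + a)) (t • x)
    rw [← h, norm_smul, Real.norm_of_nonneg ht.le] at h2
    linarith

theorem inner_loc_expP_loc {t : ℝ} (ht : 0 < t) {a : X d} (ha : 4 ≤ t * ‖a‖) (u v : L2 d) :
    inner ℂ (mulOp (loc t 0) v) (expP a (mulOp (loc t 0) u)) = 0 := by
  have h1 : expP a (mulOp (loc t 0) u) = mulOp (shift a (loc t 0)) (expP a u) := by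
    rw [← mul_apply_eq_comp, expP_mul_mulOp, mul_apply_eq_comp]
  rw [h1, ← ContinuousLinearMap.adjoint_inner_right, adjoint_mulOp, star_loc, ← mul_apply_eq_comp,
    ← mulOp_mul, loc_mul_shift_loc ht ha]
  have : mulOp (0 : X d →ᵇ ℂ) = 0 := by
    rw [← sub_self (0 : X d →ᵇ ℂ), mulOp_sub, sub_self]
  simp [this]

/-- Truncate both vectors: far translates of truncated vectors have disjoint supports. -/
theorem tendsto_inner_expP {x : ℕ → X d} (hx : Tendsto (fun n => ‖x n‖) atTop atTop)
    (u v : L2 d) : Tendsto (fun n => inner ℂ v (expP (x n) u)) atTop (𝓝 0) := by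
  rw [Metric.tendsto_nhds]
  intro ε hε
  set δ := ε / (‖u‖ + ‖v‖ + 1) with hδ
  have hδ0 : 0 < δ := by positivity
  have h : ∀ w : L2 d, ∀ᶠ t : ℝ in 𝓝[>] 0, ‖w - mulOp (loc t 0) w‖ < δ := fun w => by
    have := (tendsto_iff_norm_sub_tendsto_zero.mp (tendsto_mulOp_loc_apply w)).mono_left
      (nhdsWithin_le_nhds (s := Set.Ioi 0))
    simp_rw [norm_sub_rev w]
    exact this.eventually (gt_mem_nhds hδ0)
  obtain ⟨t, ⟨hu, hv⟩, ht⟩ := (((h u).and (h v)).and self_mem_nhdsWithin).exists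
  filter_upwards [(hx.const_mul_atTop ht).eventually_ge_atTop 4] with n hn
  have h1 : inner ℂ v (expP (x n) u) = inner ℂ (v - mulOp (loc t 0) v) (expP (x n) u) +
      inner ℂ (mulOp (loc t 0) v) (expP (x n) (u - mulOp (loc t 0) u)) := by
    rw [map_sub, inner_sub_right, inner_loc_expP_loc ht hn, inner_sub_left]
    ring
  rw [dist_zero_right, h1]
  refine (norm_add_le _ _).trans_lt ?_
  have h2 := norm_inner_le_norm (𝕜 := ℂ) (v - mulOp (loc t 0) v) (expP (x n) u)
  have h3 := norm_inner_le_norm (𝕜 := ℂ) (mulOp (loc t 0) v) (expP (x n) (u - mulOp (loc t 0) u))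
  rw [norm_expP_apply] at h2 h3
  have h4 : ‖mulOp (loc t 0) v‖ ≤ ‖v‖ :=
    (norm_mulOp_apply_le _ _).trans (mul_le_of_le_one_left (norm_nonneg _) (norm_loc_le _ _))
  have h5 : δ * (‖u‖ + ‖v‖) < ε := by
    rw [hδ, div_mul_eq_mul_div, div_lt_iff₀ (by positivity)]
    nlinarith [norm_nonneg u, norm_nonneg v]
  have h6 : ‖v - mulOp (loc t 0) v‖ * ‖u‖ ≤ δ * ‖u‖ := by gcongr
  have h7 : ‖mulOp (loc t 0) v‖ * ‖u - mulOp (loc t 0) u‖ ≤ ‖v‖ * δ := by gcongr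
  linarith

theorem translateOp_sub_algebraMap (x : X d) (A : Op d) (z : ℂ) :
    translateOp x (A - algebraMap ℂ (Op d) z) = translateOp x A - algebraMap ℂ (Op d) z := by
  rw [translateOp, mul_sub, sub_mul, ← Algebra.commutes, mul_assoc (algebraMap ℂ (Op d) z),
    expP_mul_neg, mul_one]
  rfl

/-- Apply the bound to `expP (-x k) u`: these vectors tend weakly to zero, so the finite rank term
disappears in the limit. -/
theorem bound_of_mem_operatorSpectrum {A B : Op d} (hB : B ∈ operatorSpectrum A) {z : ℂ} {C : ℝ}
    {n : ℕ} {a b : Fin n → L2 d}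
    (h : ∀ u, ‖u‖ ≤ C * ‖(A - algebraMap ℂ (Op d) z) u‖ + ‖finRank a b u‖) (u : L2 d) :
    ‖u‖ ≤ C * ‖(B - algebraMap ℂ (Op d) z) u‖ := by
  obtain ⟨x, hx, hxB⟩ := mem_operatorSpectrum_iff.mp hB
  have h1 := tendsto_apply_of_tendsto_mul_weight (fun n => (norm_translateOp (x n) A).le) hxB u
  have h2 : Tendsto (fun k => (translateOp (x k) A - algebraMap ℂ (Op d) z) u) atTop
      (𝓝 ((B - algebraMap ℂ (Op d) z) u)) := h1.sub tendsto_const_nhds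
  have h3 : Tendsto (fun k => finRank a b (expP (-x k) u)) atTop (𝓝 0) := by
    simp_rw [finRank_apply]
    have : (0 : L2 d) = ∑ i, (0 : ℂ) • b i := by simp
    rw [this]
    refine tendsto_finsetSum _ fun i _ => ?_
    refine (tendsto_inner_expP (x := fun k => -x k) (by simpa using hx) u (a i)).smul_const (b i)
  have h4 : Tendsto (fun k => C * ‖(translateOp (x k) A - algebraMap ℂ (Op d) z) u‖ +
      ‖finRank a b (expP (-x k) u)‖) atTop (𝓝 (C * ‖(B - algebraMap ℂ (Op d) z) u‖)) := by
    simpa using (h2.norm.const_mul C).add h3.norm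
  refine ge_of_tendsto' h4 fun k => ?_
  have h5 := h (expP (-x k) u)
  rw [norm_expP_apply] at h5
  rwa [← translateOp_sub_algebraMap, translateOp, mul_apply_eq_comp, mul_apply_eq_comp,
    norm_expP_apply]

theorem adjoint_sub_algebraMap (A : Op d) (z : ℂ) :
    ContinuousLinearMap.adjoint (A - algebraMap ℂ (Op d) z) =
      ContinuousLinearMap.adjoint A - algebraMap ℂ (Op d) (starRingEnd ℂ z) := by
  rw [map_sub, Algebra.algebraMap_eq_smul_one, Algebra.algebraMap_eq_smul_one,
    LinearIsometryEquiv.map_smulₛₗ, adjoint_one]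

theorem isUnit_sub_of_isFredholm {A B : Op d} (hA : A ∈ ellipticAlgebra d)
    (hB : B ∈ operatorSpectrum A) {z : ℂ} (hz : (A - algebraMap ℂ (Op d) z).IsFredholm) :
    IsUnit (B - algebraMap ℂ (Op d) z) := by
  obtain ⟨C, n, a, b, m, a', b', h, h'⟩ := exists_estimates_of_isFredholm hz
  rw [adjoint_sub_algebraMap] at h'
  have hB' : ContinuousLinearMap.adjoint B ∈ operatorSpectrum (ContinuousLinearMap.adjoint A) := by
    refine adjoint_mem_operatorSpectrum (adjoint_mem_ellipticAlgebra hA) ?_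
    rwa [ContinuousLinearMap.adjoint_adjoint]
  refine isUnit_of_estimates (bound_of_mem_operatorSpectrum hB h) (C' := C) ?_
  rw [adjoint_sub_algebraMap]
  exact bound_of_mem_operatorSpectrum hB' h'

/-! ### Operators of the elliptic algebra are not invertible -/

theorem one_le_norm_expP_sub_one {a : X d} (ha : a ≠ 0) : 1 ≤ ‖expP a - 1‖ := by
  have ha0 : 0 < ‖a‖ := norm_pos_iff.mpr ha
  -- The test vector is a multiple of the indicator of the ball of radius `‖a‖ / 4`; its translate
  -- by `a` is orthogonal to it.
  set t := 4 / ‖a‖ with ht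
  have ht0 : 0 < t := by positivity
  set u : L2 d := ballAverage d t⁻¹ with hu
  have hV : 0 < volume.real (Metric.ball (0 : X d) t⁻¹) :=
    ENNReal.toReal_pos (Metric.measure_ball_pos volume _ (by positivity)).ne'
      measure_ball_lt_top.ne
  have hu0 : 0 < ‖u‖ := by
    rw [hu, ballAverage, norm_indicatorConstLp (by norm_num) (by norm_num)]
    exact mul_pos (norm_pos_iff.mpr (inv_ne_zero (Complex.ofReal_ne_zero.mpr hV.ne')))
      (Real.rpow_pos_of_pos hV _)
  have hloc : mulOp (loc t 0) u = u := by
    refine Lp.ext ?_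
    filter_upwards [mulOp_apply_ae (loc t 0) u, indicatorConstLp_coeFn (p := 2)
      (hs := measurableSet_ball (x := (0 : X d)) (ε := t⁻¹)) (hμs := measure_ball_lt_top.ne)
      (c := ((volume.real (Metric.ball (0 : X d) t⁻¹))⁻¹ : ℂ))] with x h1 h2
    rw [h1]
    by_cases hx : x ∈ Metric.ball (0 : X d) t⁻¹
    · rw [loc_zero_eq_one ht0.le, one_mul]
      rw [mem_ball_zero_iff] at hx
      calc t * ‖x‖ ≤ t * t⁻¹ := by gcongr
        _ = 1 := mul_inv_cancel₀ ht0.ne'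
    · rw [Set.indicator_of_notMem hx] at h2
      rw [hu, ballAverage, h2, mul_zero]
  have h1 := inner_loc_expP_loc ht0 (a := a) (by rw [ht]; field_simp; rfl) u u
  rw [hloc] at h1
  have h2 : ‖u‖ ≤ ‖(expP a - 1) u‖ := by
    have h3 : inner ℂ u ((expP a - 1) u) = -(‖u‖ : ℂ) ^ 2 := by
      rw [sub_apply, inner_sub_right, h1, one_apply_eq_self,
        inner_self_eq_norm_sq_to_K, zero_sub]
      rfl
    have h4 := norm_inner_le_norm (𝕜 := ℂ) u ((expP a - 1) u)
    rw [h3, norm_neg, norm_pow, Complex.norm_real, norm_norm, sq] at h4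
    exact le_of_mul_le_mul_left h4 hu0
  have h5 := h2.trans ((expP a - 1).le_opNorm u)
  exact le_of_mul_le_mul_right (by simpa using h5) hu0

/-- Multiplying by the inverse would give `expP a → 1` in norm as `a → 0`, contrary to
`one_le_norm_expP_sub_one`. -/
theorem not_isUnit_of_mem_ellipticAlgebra (hd : d ≠ 0) {B : Op d} (hB : B ∈ ellipticAlgebra d) :
    ¬ IsUnit B := by
  rintro ⟨U, rfl⟩
  have : NeZero d := ⟨hd⟩
  have : Nontrivial (X d) := inferInstance
  have h1 : Tendsto (fun a : X d => ‖(expP a - 1) * (U : Op d)‖ * ‖(↑U⁻¹ : Op d)‖) (𝓝[≠] 0)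
      (𝓝 0) := by
    simpa using (hB.1.mono_left nhdsWithin_le_nhds).mul_const ‖(↑U⁻¹ : Op d)‖
  have h2 : ∀ᶠ a : X d in 𝓝[≠] 0, 1 ≤ ‖(expP a - 1) * (U : Op d)‖ * ‖(↑U⁻¹ : Op d)‖ := by
    filter_upwards [self_mem_nhdsWithin] with a ha
    refine (one_le_norm_expP_sub_one ha).trans ?_
    calc ‖expP a - 1‖ = ‖(expP a - 1) * (U : Op d) * (↑U⁻¹ : Op d)‖ := by
          rw [mul_assoc, Units.mul_inv, mul_one]
      _ ≤ _ := norm_mul_le _ _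
  have h3 := ge_of_tendsto h1 h2
  linarith

theorem operatorSpectrum_nonempty (hd : d ≠ 0) {A : Op d} (hA : A ∈ ellipticAlgebra d) :
    (operatorSpectrum A).Nonempty := by
  have : NeZero d := ⟨hd⟩
  obtain ⟨e, he⟩ := exists_ne (0 : X d)
  have hx : Tendsto (fun n : ℕ => ‖(n : ℝ) • e‖) atTop atTop := by
    simp_rw [norm_smul, Real.norm_natCast]
    exact tendsto_natCast_atTop_atTop.atTop_mul_const (norm_pos_iff.mpr he)
  obtain ⟨B, hB, -⟩ := exists_subseq_translateOp hA hx
  exact ⟨B, hB⟩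

/-! ### Localization of approximate eigenvectors -/

theorem continuous_mulOp_loc_apply (t : ℝ) (u : L2 d) :
    Continuous fun z : X d => mulOp (loc t z) u := by
  simp_rw [mulOp_loc_apply]
  have h : ∀ z k : X d, ‖Complex.exp (-(2 * Real.pi * inner ℝ k z) * Complex.I)‖ = 1 :=
    fun z k => by
      rw [show (-(2 * Real.pi * inner ℝ k z) : ℂ) = ((-(2 * Real.pi * inner ℝ k z) : ℝ) : ℂ) by
        push_cast; rfl, Complex.norm_exp_ofReal_mul_I]
  have hc : Continuous fun k : X d => expQ ((2 * Real.pi * t) • k) u :=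
    (continuous_expQ_apply u).comp (continuous_const_smul _)
  refine continuous_of_dominated (bound := fun k => ‖bumpHat d k‖ * ‖u‖) (fun z => ?_)
    (fun z => Eventually.of_forall fun k => ?_) ((bumpHat d).integrable.norm.mul_const _)
    (Eventually.of_forall fun k => ?_)
  · have hb : Continuous fun k : X d => bumpHat d k *
        Complex.exp (-(2 * Real.pi * inner ℝ k z) * Complex.I) :=
      (bumpHat d).continuous.mul (by fun_prop)
    exact (hb.smul hc).aestronglyMeasurable
  · rw [norm_smul, norm_mul, h, mul_one, norm_expQ_apply]
  · have hb : Continuous fun z : X d => bumpHat d k *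
        Complex.exp (-(2 * Real.pi * inner ℝ k z) * Complex.I) := by fun_prop
    exact hb.smul continuous_const

variable (d) in
/-- The squared `L²` norm of the bump function. -/
def bumpMass : ℝ≥0∞ := ∫⁻ z, ‖bump d z‖ₑ ^ 2

theorem lintegral_enorm_sq_ne_top (g : SchwartzMap (X d) ℂ) : ∫⁻ k, ‖g k‖ₑ ^ 2 ≠ ∞ := by
  have h := lintegral_rpow_enorm_lt_top_of_eLpNorm_lt_top (by simp) (by simp)
    (g.memLp 2 volume).eLpNorm_lt_top
  simpa using h.ne

theorem bumpMass_ne_top : bumpMass d ≠ ∞ := lintegral_enorm_sq_ne_top _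

theorem bumpMass_ne_zero : bumpMass d ≠ 0 := by
  have h : volume (Metric.ball (0 : X d) 1) ≤ bumpMass d := by
    rw [← setLIntegral_one]
    refine (setLIntegral_mono' measurableSet_ball fun x hx => ?_).trans (setLIntegral_le_lintegral _ _)
    rw [bump_eq_one (mem_ball_zero_iff.mp hx).le]
    simp
  exact ((Metric.measure_ball_pos volume _ one_pos).trans_le h).ne'

theorem lintegral_bump_sub (x : X d) : ∫⁻ z, ‖bump d (x - z)‖ₑ ^ 2 = bumpMass d :=
  lintegral_sub_left_eq_self (fun z => ‖bump d z‖ₑ ^ 2) x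

theorem lintegral_mul_setLIntegral_bump (t : ℝ) (B : Set (X d)) (u : L2 d) :
    ∫⁻ x, ‖u x‖ₑ ^ 2 * ∫⁻ z in B, ‖bump d (t • x - z)‖ₑ ^ 2 =
      ∫⁻ z in B, ‖mulOp (loc t z) u‖ₑ ^ 2 := by
  have hb : Measurable fun p : X d × X d => ‖bump d (t • p.1 - p.2)‖ₑ ^ 2 :=
    ((bump d).continuous.comp (by fun_prop)).enorm.measurable.pow_const 2
  have h1 : ∀ x : X d, ‖u x‖ₑ ^ 2 * ∫⁻ z in B, ‖bump d (t • x - z)‖ₑ ^ 2 =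
      ∫⁻ z in B, ‖u x‖ₑ ^ 2 * ‖bump d (t • x - z)‖ₑ ^ 2 := fun x =>
    (lintegral_const_mul' _ _ (by simp)).symm
  simp_rw [h1]
  rw [lintegral_lintegral_swap]
  · refine lintegral_congr fun z => ?_
    rw [enorm_sq_eq_lintegral]
    refine lintegral_congr_ae ?_
    filter_upwards [mulOp_apply_ae (loc t z) u] with x hx
    rw [hx, enorm_mul, mul_pow, mul_comm, loc_apply]
  · exact ((((Lp.stronglyMeasurable u).enorm.pow_const 2).comp measurable_fst).mul hb).aemeasurable

/-- A vector which is approximately killed by `T` at several scales and is small near the origin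
has, away from the origin, localizations at all these scales approximately killed by `T`. -/
theorem exists_good_point (T : Op d) {u : L2 d} (hu : ‖u‖ = 1) {N : ℕ} {t : ℕ → ℝ}
    {ε κ : ℕ → ℝ≥0∞} (hε : ∀ j, ε j ≠ 0) (hε' : ∀ j, ε j ≠ ∞)
    (hκ : ∑ j ∈ Finset.range N, κ j ≤ 1 / 2)
    (h : ∀ j < N, ∫⁻ z, ‖T (mulOp (loc (t j) z) u)‖ₑ ^ 2 ≤ ε j ^ 2 * (κ j * bumpMass d))
    {s : ℝ} (hs0 : 0 ≤ s) (hs : ‖mulOp (loc s 0) u‖ ≤ 1 / 2) :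
    ∃ x : X d, 1 < s * ‖x‖ ∧ ∀ j < N, ∃ z, bump d (t j • x - z) ≠ 0 ∧
      ‖T (mulOp (loc (t j) z) u)‖ₑ < ε j * ‖mulOp (loc (t j) z) u‖ₑ := by
  by_contra! hcon
  -- The bad centres at scale `t j`.
  set B : ℕ → Set (X d) := fun j =>
    {z | ε j * ‖mulOp (loc (t j) z) u‖ₑ ≤ ‖T (mulOp (loc (t j) z) u)‖ₑ} with hB
  have hBm : ∀ j, MeasurableSet (B j) := fun j => by
    have hc := continuous_mulOp_loc_apply (t j) u
    exact measurableSet_le (hc.enorm.measurable.const_mul _)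
      (T.continuous.comp hc).enorm.measurable
  -- By contradiction, every `x` far from the origin has a scale at which all the cut-offs that are
  -- nonzero at `x` have bad centres, so these carry the full bump mass. Near points are paid for by
  -- the cut-off at the origin.
  have h1 : ∀ x : X d, bumpMass d ≤ (∑ j ∈ Finset.range N, ∫⁻ z in B j, ‖bump d (t j • x - z)‖ₑ ^ 2)
      + bumpMass d * ‖loc s 0 x‖ₑ ^ 2 := fun x => by
    by_cases hx : 1 < s * ‖x‖
    · obtain ⟨j, hj, hjz⟩ := hcon x hx
      refine le_add_right ?_
      refine le_trans ?_ (Finset.single_le_sum (fun _ _ => zero_le) (Finset.mem_range.mpr hj))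
      rw [← lintegral_bump_sub (t j • x), ← lintegral_indicator (hBm j)]
      refine lintegral_mono fun z => ?_
      by_cases hz : bump d (t j • x - z) = 0
      · simp [hz]
      · rw [Set.indicator_of_mem (show z ∈ B j from hjz z hz)]
    · rw [loc_zero_eq_one hs0 (not_lt.mp hx)]
      simp
  have hu2 : ∫⁻ x, ‖u x‖ₑ ^ 2 = 1 := by
    rw [← enorm_sq_eq_lintegral, ← ofReal_norm, hu]
    simp
  have hum : Measurable fun x => ‖u x‖ₑ ^ 2 := (Lp.stronglyMeasurable u).enorm.pow_const 2
  have hbm : ∀ j, Measurable fun x : X d => ∫⁻ z in B j, ‖bump d (t j • x - z)‖ₑ ^ 2 := fun j => by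
    refine Measurable.lintegral_prod_right'
      (f := fun p : X d × X d => ‖bump d (t j • p.1 - p.2)‖ₑ ^ 2) ?_
    exact ((bump d).continuous.comp (by fun_prop)).enorm.measurable.pow_const 2
  have h2 : bumpMass d ≤ (∑ j ∈ Finset.range N, ∫⁻ z in B j, ‖mulOp (loc (t j) z) u‖ₑ ^ 2)
      + bumpMass d * ‖mulOp (loc s 0) u‖ₑ ^ 2 := by
    calc bumpMass d = ∫⁻ x, ‖u x‖ₑ ^ 2 * bumpMass d := by
          rw [lintegral_mul_const _ hum, hu2, one_mul]
      _ ≤ ∫⁻ x, ((∑ j ∈ Finset.range N, ‖u x‖ₑ ^ 2 * ∫⁻ z in B j, ‖bump d (t j • x - z)‖ₑ ^ 2)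
          + bumpMass d * ‖mulOp (loc s 0) u x‖ₑ ^ 2) := by
          refine lintegral_mono_ae ?_
          filter_upwards [mulOp_apply_ae (loc s 0) u] with x hx
          refine (mul_le_mul_right (h1 x) _).trans_eq ?_
          rw [hx, mul_add, Finset.mul_sum, enorm_mul, mul_pow]
          ring
      _ = _ := by
          rw [lintegral_add_left, lintegral_finsetSum, lintegral_const_mul' _ _ bumpMass_ne_top,
            ← enorm_sq_eq_lintegral]
          · simp_rw [lintegral_mul_setLIntegral_bump]
          · exact fun j _ => hum.mul (hbm j)
          · exact Finset.measurable_fun_sum _ fun j _ => hum.mul (hbm j)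
  -- Chebyshev's inequality on the bad centres.
  have h3 : ∀ j ∈ Finset.range N, ∫⁻ z in B j, ‖mulOp (loc (t j) z) u‖ₑ ^ 2 ≤
      κ j * bumpMass d := fun j hj => by
    have h4 : ε j ^ 2 * ∫⁻ z in B j, ‖mulOp (loc (t j) z) u‖ₑ ^ 2 ≤
        ε j ^ 2 * (κ j * bumpMass d) := by
      rw [← lintegral_const_mul' _ _ (by simp [hε'])]
      refine le_trans ?_ (h j (Finset.mem_range.mp hj))
      refine (setLIntegral_mono' (hBm j) fun z hz => ?_).trans (setLIntegral_le_lintegral _ _)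
      rw [← mul_pow]
      exact pow_le_pow_left' hz 2
    exact (ENNReal.mul_le_mul_iff_right (by simp [hε]) (by simp [hε'])).mp h4
  have h5 : ‖mulOp (loc s 0) u‖ₑ ^ 2 ≤ 1 / 4 := by
    rw [← ofReal_norm, ← ENNReal.ofReal_pow (norm_nonneg _)]
    have h6 : ‖mulOp (loc s 0) u‖ ^ 2 ≤ 1 / 4 := by nlinarith [norm_nonneg (mulOp (loc s 0) u)]
    refine (ENNReal.ofReal_le_ofReal h6).trans_eq ?_
    rw [ENNReal.ofReal_div_of_pos (by norm_num)]
    norm_num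
  -- The bad centres account for at most 1/2 of the mass and the cut-off near the origin for at most
  -- 1/4.
  have h7 : bumpMass d ≤ bumpMass d * (3 / 4) := by
    calc bumpMass d ≤ (∑ j ∈ Finset.range N, κ j * bumpMass d) + bumpMass d * (1 / 4) := by
          refine h2.trans (add_le_add (Finset.sum_le_sum h3) ?_)
          exact mul_le_mul_right h5 _
      _ ≤ bumpMass d * (1 / 2) + bumpMass d * (1 / 4) := by
          rw [← Finset.sum_mul, mul_comm]
          exact add_le_add (mul_le_mul_right hκ _) le_rfl
      _ = _ := by
          rw [← mul_add]
          congr 1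
          rw [← ENNReal.toReal_eq_toReal_iff' (by finiteness) (by finiteness)]
          rw [ENNReal.toReal_add (by finiteness) (by finiteness)]
          norm_num
  have h8 : bumpMass d * (3 / 4) < bumpMass d * 1 := by
    refine (ENNReal.mul_lt_mul_iff_right bumpMass_ne_zero bumpMass_ne_top).mpr ?_
    rw [← ENNReal.toReal_lt_toReal (by finiteness) (by finiteness)]
    norm_num
  rw [mul_one] at h8
  exact h7.not_gt h8

/-- By `lintegral_enorm_sq_mulOp_loc` it suffices to bound `T` on modulated vectors. There `T`
commutes with the modulation `E` up to `A * E - E * A`, since scalars commute with `E`. A small `t`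
controls the commutator term and a small `δ` the remaining one. -/
theorem exists_scale {A : Op d} (hA : A ∈ ellipticAlgebra d) (z : ℂ) {γ : ℝ≥0∞} (hγ : γ ≠ 0) :
    ∃ t > 0, ∃ δ > 0, ∀ u : L2 d, ‖u‖ = 1 → ‖(A - algebraMap ℂ (Op d) z) u‖ ≤ δ →
      ∫⁻ w, ‖(A - algebraMap ℂ (Op d) z) (mulOp (loc t w) u)‖ₑ ^ 2 ≤ γ := by
  set T := A - algebraMap ℂ (Op d) z with hT
  set M := ∫⁻ k, ‖bumpHat d k‖ₑ ^ 2 with hM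
  have hMt : M ≠ ∞ := lintegral_enorm_sq_ne_top _
  have h1 : Tendsto (fun t : ℝ => 4 * slowModulus A 2 t) (𝓝[>] 0) (𝓝 0) := by
    have := ENNReal.Tendsto.const_mul (a := 4)
      ((tendsto_slowModulus hA two_ne_zero).mono_left (nhdsWithin_le_nhds (s := Set.Ioi 0)))
      (Or.inr (by simp))
    rwa [mul_zero] at this
  have h2 : Tendsto (fun δ : ℝ => 4 * (ENNReal.ofReal δ ^ 2 * M)) (𝓝[>] 0) (𝓝 0) := by
    have h : Tendsto (fun δ : ℝ => ENNReal.ofReal δ) (𝓝[>] 0) (𝓝 0) := by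
      have := (ENNReal.continuous_ofReal.tendsto 0).mono_left
        (nhdsWithin_le_nhds (s := Set.Ioi (0 : ℝ)))
      rwa [ENNReal.ofReal_zero] at this
    have h' := ENNReal.Tendsto.const_mul (a := 4) (ENNReal.Tendsto.mul_const (b := M)
      (ENNReal.Tendsto.pow (n := 2) h) (Or.inr hMt)) (Or.inr (by simp))
    simpa using h'
  have hγ2 : 0 < γ / 2 := ENNReal.half_pos hγ
  obtain ⟨t, ht, ht0⟩ := ((h1.eventually (gt_mem_nhds hγ2)).and self_mem_nhdsWithin).exists
  obtain ⟨δ, hδ, hδ0⟩ := ((h2.eventually (gt_mem_nhds hγ2)).and self_mem_nhdsWithin).exists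
  refine ⟨t, ht0, δ, hδ0, fun u hu hTu => ?_⟩
  rw [lintegral_enorm_sq_mulOp_loc]
  have h3 : ∀ k : X d, (‖bumpHat d k‖ₑ * ‖T (expQ ((2 * Real.pi * t) • k) u)‖ₑ) ^ 2 ≤
      4 * ((‖bumpHat d k‖ₑ * ‖A * expQ ((2 * Real.pi * t) • k) -
        expQ ((2 * Real.pi * t) • k) * A‖ₑ) ^ 2) +
      4 * (ENNReal.ofReal δ ^ 2 * ‖bumpHat d k‖ₑ ^ 2) := fun k => by
    set E := expQ ((2 * Real.pi * t) • k) with hE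
    have h4 : T (E u) = (A * E - E * A) u + E (T u) := by
      have : T * E = (A * E - E * A) + E * T := by
        rw [hT, sub_mul, mul_sub, Algebra.commutes]
        abel
      rw [← mul_apply_eq_comp, this]
      rfl
    have h5 : ‖T (E u)‖ₑ ≤ ‖A * E - E * A‖ₑ + ENNReal.ofReal δ := by
      rw [h4]
      refine (enorm_add_le _ _).trans (add_le_add ?_ ?_)
      · refine ((A * E - E * A).le_opENorm u).trans_eq ?_
        rw [← ofReal_norm u, hu, ENNReal.ofReal_one, mul_one]
      · rw [← ofReal_norm, hE, norm_expQ_apply]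
        exact ENNReal.ofReal_le_ofReal hTu
    have h6 : ∀ a b : ℝ≥0∞, (a + b) ^ 2 ≤ 4 * a ^ 2 + 4 * b ^ 2 := fun a b => by
      have h7 : a + b ≤ 2 * max a b := by
        rw [two_mul]
        exact add_le_add (le_max_left _ _) (le_max_right _ _)
      refine (pow_le_pow_left' h7 2).trans ?_
      rw [mul_pow]
      norm_num
      rcases max_choice a b with h | h <;> rw [h]
      · exact le_self_add
      · exact le_add_self
    calc _ ≤ (‖bumpHat d k‖ₑ * ‖A * E - E * A‖ₑ + ‖bumpHat d k‖ₑ * ENNReal.ofReal δ) ^ 2 := by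
          rw [← mul_add]
          exact pow_le_pow_left' (mul_le_mul_right h5 _) 2
      _ ≤ _ := (h6 _ _).trans_eq (by rw [mul_pow _ (ENNReal.ofReal δ)]; ring)
  calc _ ≤ _ := lintegral_mono h3
    _ = 4 * slowModulus A 2 t + 4 * (ENNReal.ofReal δ ^ 2 * M) := by
        rw [lintegral_add_right, lintegral_const_mul' _ _ (by simp),
          lintegral_const_mul' _ _ (by simp), lintegral_const_mul' _ _ (by simp)]
        · rfl
        · exact (((bumpHat d).continuous.enorm.measurable.pow_const 2).const_mul _).const_mul _
    _ ≤ γ / 2 + γ / 2 := add_le_add ht.le hδ.le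
    _ = γ := ENNReal.add_halves γ

/-! ### The essential spectrum -/

/-- When the cut-off is nonzero at `x`, translation by `x` brings the localized vector into the ball
of radius `4 / t` about the origin, where the larger cut-off is 1. -/
theorem mulOp_expP_mulOp_loc {t : ℝ} (ht : 0 < t) {x z : X d} (hz : bump d (t • x - z) ≠ 0)
    (u : L2 d) :
    mulOp (loc (t / 4) 0) (expP x (mulOp (loc t z) u)) = expP x (mulOp (loc t z) u) := by
  rw [← mul_apply_eq_comp (expP x), expP_mul_mulOp, mul_apply_eq_comp, ← mul_apply_eq_comp,
    ← mulOp_mul]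
  congr 2
  ext y
  rw [BoundedContinuousFunction.mul_apply, shift_apply, loc_apply t]
  by_cases hy : bump d (t • (y + x) - z) = 0
  · rw [hy, mul_zero]
  · have h1 : ‖t • x - z‖ < 2 := not_le.mp fun h => hz (bump_eq_zero h)
    have h2 : ‖t • (y + x) - z‖ < 2 := not_le.mp fun h => hy (bump_eq_zero h)
    have h3 := norm_sub_le (t • (y + x) - z) (t • x - z)
    rw [sub_sub_sub_cancel_right, ← smul_sub, add_sub_cancel_right, norm_smul,
      Real.norm_of_nonneg ht.le] at h3
    rw [loc_zero_eq_one (by positivity) (by linarith), one_mul]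

/-- If `A - z` has approximate null vectors which are not concentrated near the origin, then
`B - z` is not invertible for some `B` in the operator spectrum of `A`. -/
theorem exists_mem_operatorSpectrum_not_isUnit {A : Op d} (hA : A ∈ ellipticAlgebra d) {z : ℂ}
    (hW : ∀ δ > 0, ∀ s > 0, ∃ u : L2 d, ‖u‖ = 1 ∧ ‖(A - algebraMap ℂ (Op d) z) u‖ ≤ δ ∧
      ‖mulOp (loc s 0) u‖ ≤ 1 / 2) :
    ∃ B ∈ operatorSpectrum A, ¬ IsUnit (B - algebraMap ℂ (Op d) z) := by
  -- Each scale `j` receives a share `κ j` of the mass for its bad centres. The total stays below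
  -- 1/2, so any number of scales can be treated together, and `t j`, `δ j` do not depend on that
  -- number.
  obtain ⟨κ, hκ0, hκ⟩ := ENNReal.exists_pos_sum_of_countable (ε := 1 / 2) (by simp) ℕ
  set ε : ℕ → ℝ := fun j => 1 / (j + 1) with hεdef
  have hε0 : ∀ j, 0 < ε j := fun j => Nat.one_div_pos_of_nat
  have hε : ∀ j, ENNReal.ofReal (ε j) ≠ 0 := fun j => by simpa using hε0 j
  choose t ht δ hδ hscale using fun j => exists_scale hA z
    (γ := ENNReal.ofReal (ε j) ^ 2 * (κ j * bumpMass d))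
    (mul_ne_zero (pow_ne_zero 2 (hε j))
      (mul_ne_zero (by simpa using (hκ0 j).ne') bumpMass_ne_zero))
  have key : ∀ n : ℕ, ∃ (u : L2 d) (x : X d), 1 < ε n * ‖x‖ ∧ ∀ j < n, ∃ w,
      bump d (t j • x - w) ≠ 0 ∧ ‖(A - algebraMap ℂ (Op d) z) (mulOp (loc (t j) w) u)‖ₑ <
        ENNReal.ofReal (ε j) * ‖mulOp (loc (t j) w) u‖ₑ := fun n => by
    -- Only `j < n` matters; `n + 1` keeps the minimum defined when `n = 0`.
    have hne : (Finset.range (n + 1)).Nonempty := ⟨0, by simp⟩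
    obtain ⟨u, hu, hTu, hu'⟩ := hW ((Finset.range (n + 1)).inf' hne δ)
      ((Finset.lt_inf'_iff hne).mpr fun j _ => hδ j) (ε n) (hε0 n)
    obtain ⟨x, hx⟩ := exists_good_point (N := n) _ hu hε (by simp)
      ((ENNReal.sum_le_tsum _).trans hκ.le) (fun j hj => hscale j u hu
        (hTu.trans (Finset.inf'_le _ (Finset.mem_range.mpr (by omega))))) (hε0 n).le hu'
    exact ⟨u, x, hx⟩
  choose u x hx hloc using key
  have hxt : Tendsto (fun n => ‖x n‖) atTop atTop := by
    refine tendsto_atTop_mono (fun n => ?_) tendsto_natCast_atTop_atTop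
    have h := hx n
    rw [hεdef, one_div_mul_eq_div, lt_div_iff₀ (by positivity), one_mul] at h
    linarith
  obtain ⟨C, hC, φ, hφ, hlim⟩ := exists_subseq_translateOp hA hxt
  refine ⟨C, hC, ?_⟩
  rintro ⟨U, hU⟩
  set M := ‖(↑U⁻¹ : Op d)‖
  have hM : ∀ v, ‖v‖ ≤ M * ‖(C - algebraMap ℂ (Op d) z) v‖ := fun v => by
    rw [← hU]
    calc ‖v‖ = ‖((↑U⁻¹ : Op d) * (U : Op d)) v‖ := by rw [Units.inv_mul, one_apply_eq_self]
      _ ≤ _ := (↑U⁻¹ : Op d).le_opNorm _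
  -- The accuracy is chosen only now, after the limit operator and the norm `M` of the inverse are
  -- known; the points `x n` with `n > j` already serve this scale.
  obtain ⟨j, hj⟩ := exists_nat_one_div_lt (show (0 : ℝ) < (2 * M + 1)⁻¹ by positivity)
  obtain ⟨g, hg⟩ := exists_eq_weight_mul (loc (t j / 4) (0 : X d))
    (hasCompactSupport_loc (by have := ht j; positivity) 0)
  have hlim' : Tendsto (fun n => ‖(C - translateOp (x (φ n)) A) * mulOp (loc (t j / 4) 0)‖) atTop
      (𝓝 0) := by
    have h := (tendsto_const_nhds (x := C * mulOp (weight d).toBCF)).sub hlim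
    have h' := (h.mul_const (mulOp g)).norm
    rw [sub_self, zero_mul, norm_zero] at h'
    refine h'.congr fun n => ?_
    rw [hg, mulOp_mul, ← sub_mul, mul_assoc]
  obtain ⟨n, hn, hjn⟩ := ((hlim'.eventually (gt_mem_nhds (hε0 j))).and
    (eventually_gt_atTop j)).exists
  obtain ⟨w, hw, hTw⟩ := hloc (φ n) j (hjn.trans_le (hφ.id_le n))
  set v₀ := mulOp (loc (t j) w) (u (φ n))
  set v := expP (x (φ n)) v₀ with hv
  have hθ : mulOp (loc (t j / 4) 0) v = v := mulOp_expP_mulOp_loc (ht j) hw _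
  have hTw' : ‖(A - algebraMap ℂ (Op d) z) v₀‖ < ε j * ‖v₀‖ := by
    rw [← ofReal_norm, ← ofReal_norm, ← ENNReal.ofReal_mul (hε0 j).le] at hTw
    exact (ENNReal.ofReal_lt_ofReal_iff_of_nonneg (norm_nonneg _)).mp hTw
  have hnv : ‖v‖ = ‖v₀‖ := norm_expP_apply _ _
  have hv0 : 0 < ‖v‖ := by
    rw [hnv]
    exact pos_of_mul_pos_right ((norm_nonneg _).trans_lt hTw') (hε0 j).le
  have h1 : (C - algebraMap ℂ (Op d) z) v = ((C - translateOp (x (φ n)) A) *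
      mulOp (loc (t j / 4) 0) : Op d) v + expP (x (φ n)) ((A - algebraMap ℂ (Op d) z) v₀) := by
    have h2 : translateOp (x (φ n)) (A - algebraMap ℂ (Op d) z) v =
        expP (x (φ n)) ((A - algebraMap ℂ (Op d) z) v₀) := by
      rw [hv, ← mul_apply_eq_comp _ (expP (x (φ n))), translateOp, mul_assoc _ _ (expP (x (φ n))),
        expP_neg_mul, mul_one, mul_apply_eq_comp]
    rw [mul_apply_eq_comp, hθ, ← h2, translateOp_sub_algebraMap]
    simp only [sub_apply]
    abel
  -- One `ε j` comes from replacing `C` by a translate of `A` on a fixed ball, the other from the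
  -- approximate null vector.
  have h3 : ‖(C - algebraMap ℂ (Op d) z) v‖ ≤ ε j * ‖v‖ + ε j * ‖v‖ := by
    rw [h1]
    refine (norm_add_le _ _).trans (add_le_add ?_ ?_)
    · exact (ContinuousLinearMap.le_opNorm _ _).trans (by gcongr)
    · rw [norm_expP_apply, hnv]
      exact hTw'.le
  have h4 : ε j * (2 * M + 1) < 1 := by
    have : ε j < (2 * M + 1)⁻¹ := hj
    rwa [lt_inv_comm₀ (hε0 j) (by positivity), ← one_div, lt_div_iff₀ (hε0 j), mul_comm] at this
  have h5 : ‖v‖ ≤ M * (ε j * ‖v‖ + ε j * ‖v‖) := (hM v).trans (by gcongr)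
  nlinarith [mul_pos (hε0 j) hv0, mul_lt_mul_of_pos_right h4 hv0]

/-- If the approximate null vectors of `A - z` are concentrated near the origin and `z ≠ 0`, then
`A - z` is bounded below modulo compact operators. -/
theorem exists_estimate_of_concentrated {A : Op d} (hA : A ∈ ellipticAlgebra d) {z : ℂ}
    (hz : z ≠ 0) {δ s : ℝ} (hδ : 0 < δ) (hs : 0 < s)
    (hW : ∀ u : L2 d, ‖u‖ = 1 → ‖(A - algebraMap ℂ (Op d) z) u‖ ≤ δ →
      1 / 2 < ‖mulOp (loc s 0) u‖) :
    ∃ (C : ℝ) (K : Op d), IsCompactOperator K ∧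
      ∀ u, ‖u‖ ≤ C * (‖(A - algebraMap ℂ (Op d) z) u‖ + ‖K u‖) := by
  set T := A - algebraMap ℂ (Op d) z with hT
  have hz0 : 0 < ‖z‖ := norm_pos_iff.mpr hz
  -- With accuracy `‖z‖ / 4`, the error in `2 * ‖mulOp (loc s 0) u‖` is `‖u‖ / 2`, which the left
  -- side absorbs.
  obtain ⟨n, e, b, hF⟩ := exists_finRank_mul_approx (loc s (0 : X d)) (hasCompactSupport_loc hs 0)
    hA.1 (ε := ‖z‖ / 4) (by positivity)
  replace hF := hF A le_rfl fun _ => le_rfl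
  have hW' : ∀ u, ‖u‖ ≤ δ⁻¹ * ‖T u‖ + 2 * ‖mulOp (loc s 0) u‖ := fun u => by
    rcases eq_or_ne u 0 with rfl | hu
    · simp
    have hu0 : 0 < ‖u‖ := norm_pos_iff.mpr hu
    by_cases h : ‖T u‖ ≤ δ * ‖u‖
    · have h1 := hW ((‖u‖⁻¹ : ℂ) • u) (norm_smul_inv_norm hu) (by
        rw [map_smul, norm_smul, norm_inv, Complex.norm_real, norm_norm, inv_mul_le_iff₀ hu0,
          mul_comm]
        exact h)
      rw [map_smul, norm_smul, norm_inv, Complex.norm_real, norm_norm, ← div_eq_inv_mul,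
        lt_div_iff₀ hu0] at h1
      have : 0 ≤ δ⁻¹ * ‖T u‖ := by positivity
      linarith
    · have h1 : ‖u‖ ≤ δ⁻¹ * ‖T u‖ := by
        rw [← div_eq_inv_mul, le_div_iff₀ hδ, mul_comm]
        exact (not_le.mp h).le
      have : 0 ≤ ‖mulOp (loc s 0) u‖ := norm_nonneg _
      linarith
  have hloc : ∀ u, ‖z‖ * ‖mulOp (loc s 0) u‖ ≤ ‖z‖ / 4 * ‖u‖ + ‖(finRank e b * A) u‖ + ‖T u‖ :=
    fun u => by
      -- The identity `z u = A u - T u`, localized near the origin; since `z ≠ 0` it bounds the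
      -- localized vector by a compact term and `T u`.
      have h1 : z • mulOp (loc s 0) u = (mulOp (loc s 0) * A - finRank e b * A : Op d) u +
          (finRank e b * A) u - mulOp (loc s 0) (T u) := by
        rw [hT, sub_apply, sub_apply, map_sub, mul_apply_eq_comp, Algebra.algebraMap_eq_smul_one,
          smul_apply, one_apply_eq_self, map_smul]
        abel
      rw [← norm_smul, h1]
      refine (norm_sub_le _ _).trans (add_le_add ((norm_add_le _ _).trans (add_le_add ?_ le_rfl)) ?_)
      · exact (ContinuousLinearMap.le_opNorm _ _).trans (by gcongr)
      · exact (norm_mulOp_apply_le _ _).trans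
          (mul_le_of_le_one_left (norm_nonneg _) (norm_loc_le _ _))
  refine ⟨2 * δ⁻¹ + 4 / ‖z‖, finRank e b * A, (isCompactOperator_finRank e b).comp_clm A,
    fun u => ?_⟩
  have h1 := hW' u
  have h2 := hloc u
  have h3 : ‖mulOp (loc s 0) u‖ ≤ ‖u‖ / 4 + (‖(finRank e b * A) u‖ + ‖T u‖) / ‖z‖ := by
    rw [← mul_le_mul_iff_right₀ hz0]
    refine h2.trans_eq ?_
    field_simp
    ring
  have h4 : 0 ≤ δ⁻¹ * ‖(finRank e b * A) u‖ := by positivity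
  have h5 : (2 * δ⁻¹ + 4 / ‖z‖) * (‖T u‖ + ‖(finRank e b * A) u‖) =
      2 * (δ⁻¹ * ‖T u‖) + 2 * (δ⁻¹ * ‖(finRank e b * A) u‖) +
        4 * ((‖(finRank e b * A) u‖ + ‖T u‖) / ‖z‖) := by ring
  rw [h5]
  linarith

theorem exists_mem_operatorSpectrum_or_estimate {A : Op d} (hA : A ∈ ellipticAlgebra d) {z : ℂ}
    (hz : z ≠ 0) : (∃ B ∈ operatorSpectrum A, ¬ IsUnit (B - algebraMap ℂ (Op d) z)) ∨
      ∃ (C : ℝ) (K : Op d), IsCompactOperator K ∧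
        ∀ u, ‖u‖ ≤ C * (‖(A - algebraMap ℂ (Op d) z) u‖ + ‖K u‖) := by
  by_cases hW : ∀ δ > 0, ∀ s > 0, ∃ u : L2 d, ‖u‖ = 1 ∧
      ‖(A - algebraMap ℂ (Op d) z) u‖ ≤ δ ∧ ‖mulOp (loc s 0) u‖ ≤ 1 / 2
  · exact Or.inl (exists_mem_operatorSpectrum_not_isUnit hA hW)
  · push Not at hW
    obtain ⟨δ, hδ, s, hs, h⟩ := hW
    exact Or.inr (exists_estimate_of_concentrated hA hz hδ hs h)

theorem isUnit_adjoint {T : Op d} (hT : IsUnit (ContinuousLinearMap.adjoint T)) : IsUnit T := by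
  rw [← ContinuousLinearMap.star_eq_adjoint] at hT
  exact isUnit_star.mp hT

/-- Over a point, Riesz–Kolmogorov puts the identity within 1/2 of a finite rank operator, so both
estimates hold for any operator. -/
theorem isFredholm_of_dim_zero (T : Op 0) : T.IsFredholm := by
  have h0 : ∀ a : X 0, expP a = 1 := fun a => by rw [Subsingleton.elim a 0, expP_zero]
  have h1 : Tendsto (fun a : X 0 => ‖(expP a - 1) * (1 : Op 0)‖) (𝓝 0) (𝓝 0) :=
    tendsto_const_nhds.congr fun a => by rw [h0, sub_self, zero_mul, norm_zero]
  obtain ⟨n, e, b, hF⟩ := exists_finRank_mul_approx (loc 1 (0 : X 0))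
    (hasCompactSupport_loc one_pos 0) h1 (ε := 1 / 2) (by norm_num)
  replace hF := hF 1 le_rfl fun _ => le_rfl
  have hone : mulOp (loc 1 (0 : X 0)) = 1 := by
    rw [← mulOp_one]
    congr 1
    ext x
    rw [loc_zero_eq_one zero_le_one (by rw [Subsingleton.elim x 0]; simp)]
    rfl
  rw [hone, mul_one, mul_one] at hF
  have h2 : ∀ S : Op 0, ∀ u, ‖u‖ ≤ 2 * (‖S u‖ + ‖finRank e b u‖) := fun S u => by
    have h3 : ‖(1 - finRank e b) u‖ ≤ 1 / 2 * ‖u‖ :=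
      (ContinuousLinearMap.le_opNorm _ _).trans (by gcongr)
    have h4 : u = (1 - finRank e b) u + finRank e b u := by simp
    have h5 : ‖u‖ ≤ 1 / 2 * ‖u‖ + ‖finRank e b u‖ := by
      conv_lhs => rw [h4]
      exact (norm_add_le _ _).trans (by gcongr)
    have := norm_nonneg (S u)
    linarith
  exact isFredholm_of_estimates (isCompactOperator_finRank e b) (isCompactOperator_finRank e b)
    (h2 _) (h2 _)

/-- For `z ≠ 0` the dichotomy is applied to `A` and to its adjoint: two estimates would make `A - z`
Fredholm, and a limit operator of the adjoint passes to `A` by taking adjoints. -/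
theorem exists_not_isUnit_of_not_isFredholm {A : Op d} (hA : A ∈ ellipticAlgebra d) {z : ℂ}
    (hF : ¬ (A - algebraMap ℂ (Op d) z).IsFredholm) :
    ∃ B ∈ operatorSpectrum A, ¬ IsUnit (B - algebraMap ℂ (Op d) z) := by
  rcases eq_or_ne d 0 with rfl | hd
  · exact absurd (isFredholm_of_dim_zero _) hF
  rcases eq_or_ne z 0 with rfl | hz
  · obtain ⟨B, hB⟩ := operatorSpectrum_nonempty hd hA
    refine ⟨B, hB, ?_⟩
    rw [map_zero, sub_zero]
    exact not_isUnit_of_mem_ellipticAlgebra hd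
      (regClass_subset_ellipticAlgebra hA (operatorSpectrum_subset_regClass A hB))
  rcases exists_mem_operatorSpectrum_or_estimate hA hz with h | ⟨C, K, hK, h⟩
  · exact h
  have hz' : (starRingEnd ℂ) z ≠ 0 := by simpa using hz
  rcases exists_mem_operatorSpectrum_or_estimate (adjoint_mem_ellipticAlgebra hA) hz' with
    ⟨B, hB, hBz⟩ | ⟨C', K', hK', h'⟩
  · refine ⟨_, adjoint_mem_operatorSpectrum hA hB, fun hu => hBz (isUnit_adjoint ?_)⟩
    rwa [adjoint_sub_algebraMap, Complex.conj_conj]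
  · rw [← adjoint_sub_algebraMap] at h'
    exact absurd (isFredholm_of_estimates hK hK' h h') hF

theorem essentialSpectrum_eq {A : Op d} (hA : A ∈ ellipticAlgebra d) :
    essentialSpectrum A = ⋃ B ∈ operatorSpectrum A, spectrum ℂ B := by
  ext z
  simp only [Set.mem_iUnion, exists_prop, spectrum.mem_iff,
    IsUnit.sub_iff (x := algebraMap ℂ (Op d) z)]
  refine ⟨exists_not_isUnit_of_not_isFredholm hA, ?_⟩
  rintro ⟨B, hB, hBz⟩ hz
  exact hBz (isUnit_sub_of_isFredholm hA hB hz)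

end EllipticAlgebra

end

open EllipticAlgebra
theorem theorem5p1 (d : ℕ) (A : Op d) (hA : A ∈ ellipticAlgebra d) :
    ((∀ x : X d, translateOp x A ∈ ellipticAlgebra d) ∧
      IsCompact (closure (inEllLoc (Set.range fun x : X d => translateOp x A)))) ∧
    (operatorSpectrum A ⊆ ellipticAlgebra d ∧ IsCompact (inEllLoc (operatorSpectrum A))) ∧
    essentialSpectrum A = ⋃ B ∈ operatorSpectrum A, spectrum ℂ B :=
  ⟨⟨fun x => regClass_subset_ellipticAlgebra hA (translateOp_mem_regClass x A),
    isCompact_closure_translates hA⟩,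
    ⟨(operatorSpectrum_subset_regClass A).trans (regClass_subset_ellipticAlgebra hA),
      isCompact_inEllLoc_operatorSpectrum hA⟩, essentialSpectrum_eq hA⟩
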